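/- For integers $k>i\ge 0$, a proper $(k,i)$-coloring of a finite simple undirected graph $G=(V,E)$ with $q$ colors is a map $h:V\to\binom{[q]}{k}$ assigning to every vertex a set of exactly $k$ colors such that $|h(u)\cap h(v)|\le i$ for all adjacent $u,v$; the $(k,i)$-chromatic number $\chi_k^i(G)$ is the least $q$ for which such a coloring exists. For $f:\mathbb N\to\mathbb N$, write $T(n)=O^*(f(n))$ if $T(n)=O(f(n)\,n^{c})$ for some constant $c$. Theorem. There is an algorithm with $O^*(2^n)$ time complexity that computes the $(k,k-1)$-chromatic number of a given graph on $n$ vertices. Precisely: there are a single program of a random access machine (with the logarithmic cost measure: every instruction is charged for the bit lengths of the numbers and addresses it handles, and for the product of the bit lengths in the case of multiplication and division), a function $T:\mathbb N\to\mathbb N$ with $T(n)=O^*(2^n)$, and a constant $d$, such that for all integers $k\ge 1$ and $n\ge 0$ and every graph $G$ on the vertex set $\{0,\dots,n-1\}$, the program, started with $n$, $k$ and the adjacency matrix of $G$, halts with output $\chi_k^{k-1}(G)$ within time $T(n)\cdot \ell(k)^d$, where $\ell(k)$ is the number of binary digits of $k$. In particular, for every fixed $k\ge 1$ the running time is $O^*(2^n)$.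 -/

import Mathlib

open Asymptotics Filter

/-! ### `(k, i)`-colorings -/

/-- `G` has a proper `(k, i)`-coloring with the `q` colors of the palette `Fin q`: every vertex
receives a set of exactly `k` colors, and adjacent vertices share at most `i` colors. -/
def HasKIColoring {V : Type*} (G : SimpleGraph V) (q k i : ℕ) : Prop :=
  ∃ h : V → Finset (Fin q), (∀ v, (h v).card = k) ∧
    ∀ u v, G.Adj u v → (h u ∩ h v).card ≤ i

/-- The `(k, i)`-chromatic number: the least number of colors in a proper `(k, i)`-coloring. -/
noncomputable def kiChromaticNumber {V : Type*} (G : SimpleGraph V) (k i : ℕ) : ℕ :=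
  sInf {q : ℕ | HasKIColoring G q k i}

/-- On a finite graph the minimum in `kiChromaticNumber` is attained (it is never the default
value of `sInf` on the empty set). -/
theorem kiChromaticNumber_isLeast {V : Type*} [Fintype V] (G : SimpleGraph V) (k i : ℕ) :
    IsLeast {q : ℕ | HasKIColoring G q k i} (kiChromaticNumber G k i) := by
  classical
  have hne : {q : ℕ | HasKIColoring G q k i}.Nonempty := by
    refine ⟨Fintype.card V * k, fun v => Finset.univ.image fun j : Fin k =>
      finProdFinEquiv (Fintype.equivFin V v, j), ?_, ?_⟩
    · intro v
      rw [Finset.card_image_of_injective]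
      · simp
      · intro a b hab
        simpa using hab
    · intro u v huv
      have hd : (Finset.univ.image fun j : Fin k => finProdFinEquiv (Fintype.equivFin V u, j)) ∩
          (Finset.univ.image fun j : Fin k => finProdFinEquiv (Fintype.equivFin V v, j)) = ∅ := by
        rw [← Finset.disjoint_iff_inter_eq_empty, Finset.disjoint_left]
        intro x hx hy
        simp only [Finset.mem_image, Finset.mem_univ, true_and] at hx hy
        obtain ⟨a, rfl⟩ := hx
        obtain ⟨b, hb⟩ := hy
        have h1 := finProdFinEquiv.injective hb
        have h2 : Fintype.equivFin V v = Fintype.equivFin V u := congrArg Prod.fst h1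
        exact huv.ne ((Fintype.equivFin V).injective h2).symm
      rw [hd]
      simp
  exact ⟨Nat.sInf_mem hne, fun q hq => Nat.sInf_le hq⟩

/-! ### Random access machine with logarithmic cost

A machine has registers and a random access memory; every register and every memory cell holds a
natural number.  A program mentions only finitely many registers (by fixed names); the memory is
reached indirectly, through addresses held in registers. -/

/-- The arithmetic instructions.  Subtraction is truncated at `0`, and division is integer division
(with quotient `0` and remainder `a` for the divisor `0`). -/
inductive ArithOp where
  | add | sub | mul | div | mod

def ArithOp.eval : ArithOp → ℕ → ℕ → ℕ
  | .add, a, b => a + b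
  | .sub, a, b => a - b
  | .mul, a, b => a * b
  | .div, a, b => a / b
  | .mod, a, b => a % b

/-- Cost of an arithmetic instruction, in bit operations: linear in the bit lengths of the operands
for addition and subtraction, and schoolbook (product of the bit lengths) for multiplication and
division.  Here `Nat.size a` is the number of binary digits of `a`. -/
def ArithOp.cost : ArithOp → ℕ → ℕ → ℕ
  | .add, a, b => 1 + Nat.size a + Nat.size b
  | .sub, a, b => 1 + Nat.size a + Nat.size b
  | .mul, a, b => (1 + Nat.size a) * (1 + Nat.size b)
  | .div, a, b => (1 + Nat.size a) * (1 + Nat.size b)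
  | .mod, a, b => (1 + Nat.size a) * (1 + Nat.size b)

/-- Programs of the machine.  Register names are natural numbers. -/
inductive RAMProgram where
  /-- do nothing -/
  | skip
  /-- `reg x := c` -/
  | const (x c : ℕ)
  /-- `reg x := reg y op reg z` -/
  | arith (op : ArithOp) (x y z : ℕ)
  /-- `reg x := mem (reg y)` -/
  | load (x y : ℕ)
  /-- `mem (reg x) := reg y` -/
  | store (x y : ℕ)
  /-- run the first program, then the second -/
  | seq (p q : RAMProgram)
  /-- if `reg x` is nonzero run the first program, otherwise the second -/
  | cond (x : ℕ) (p q : RAMProgram)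
  /-- as long as `reg x` is nonzero, run the program -/
  | loop (x : ℕ) (p : RAMProgram)

/-- A state of the machine: the contents of the registers and of the memory. -/
structure RAMState where
  reg : ℕ → ℕ
  mem : ℕ → ℕ

/-- `RAMRun p s t s'`: started in the state `s`, the program `p` halts in the state `s'`, and the
total cost of the executed instructions and tests is `t`.  Each of them costs at least `1` and is
charged for the bit lengths of all the values and memory addresses that it handles. -/
inductive RAMRun : RAMProgram → RAMState → ℕ → RAMState → Prop where
  | skip (s : RAMState) : RAMRun .skip s 1 s
  | const (s : RAMState) (x c : ℕ) :
      RAMRun (.const x c) s (1 + Nat.size c) ⟨Function.update s.reg x c, s.mem⟩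
  | arith (s : RAMState) (op : ArithOp) (x y z : ℕ) :
      RAMRun (.arith op x y z) s (op.cost (s.reg y) (s.reg z))
        ⟨Function.update s.reg x (op.eval (s.reg y) (s.reg z)), s.mem⟩
  | load (s : RAMState) (x y : ℕ) :
      RAMRun (.load x y) s (1 + Nat.size (s.reg y) + Nat.size (s.mem (s.reg y)))
        ⟨Function.update s.reg x (s.mem (s.reg y)), s.mem⟩
  | store (s : RAMState) (x y : ℕ) :
      RAMRun (.store x y) s (1 + Nat.size (s.reg x) + Nat.size (s.reg y))
        ⟨s.reg, Function.update s.mem (s.reg x) (s.reg y)⟩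
  | seq {p q : RAMProgram} {s s' s'' : RAMState} {t t' : ℕ}
      (hp : RAMRun p s t s') (hq : RAMRun q s' t' s'') : RAMRun (.seq p q) s (t + t') s''
  | cond_true {x : ℕ} {p q : RAMProgram} {s s' : RAMState} {t : ℕ}
      (hx : s.reg x ≠ 0) (hp : RAMRun p s t s') :
      RAMRun (.cond x p q) s (1 + Nat.size (s.reg x) + t) s'
  | cond_false {x : ℕ} {p q : RAMProgram} {s s' : RAMState} {t : ℕ}
      (hx : s.reg x = 0) (hq : RAMRun q s t s') :
      RAMRun (.cond x p q) s (1 + Nat.size (s.reg x) + t) s'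
  | loop_stop {x : ℕ} {p : RAMProgram} {s : RAMState} (hx : s.reg x = 0) :
      RAMRun (.loop x p) s (1 + Nat.size (s.reg x)) s
  | loop_step {x : ℕ} {p : RAMProgram} {s s' s'' : RAMState} {t t' : ℕ}
      (hx : s.reg x ≠ 0) (hp : RAMRun p s t s') (hr : RAMRun (.loop x p) s' t' s'') :
      RAMRun (.loop x p) s (1 + Nat.size (s.reg x) + t + t') s''

/-- The machine is deterministic: the cost and the final state are determined by the program and
the initial state. -/
theorem RAMRun.deterministic {p : RAMProgram} {s s₁ s₂ : RAMState} {t₁ t₂ : ℕ}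
    (h₁ : RAMRun p s t₁ s₁) (h₂ : RAMRun p s t₂ s₂) : t₁ = t₂ ∧ s₁ = s₂ := by
  induction h₁ generalizing t₂ s₂ with
  | skip | const | arith | load | store => cases h₂; exact ⟨rfl, rfl⟩
  | seq _ _ ihp ihq =>
    cases h₂ with
    | seq hp hq =>
      obtain ⟨rfl, rfl⟩ := ihp hp
      obtain ⟨rfl, rfl⟩ := ihq hq
      exact ⟨rfl, rfl⟩
  | cond_true hx _ ih =>
    cases h₂ with
    | cond_true _ hp => obtain ⟨rfl, rfl⟩ := ih hp; exact ⟨rfl, rfl⟩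
    | cond_false hx' _ => exact absurd hx' hx
  | cond_false hx _ ih =>
    cases h₂ with
    | cond_true hx' _ => exact absurd hx hx'
    | cond_false _ hq => obtain ⟨rfl, rfl⟩ := ih hq; exact ⟨rfl, rfl⟩
  | loop_stop hx =>
    cases h₂ with
    | loop_stop _ => exact ⟨rfl, rfl⟩
    | loop_step hx' _ _ => exact absurd hx hx'
  | loop_step hx _ _ ihp ihr =>
    cases h₂ with
    | loop_stop hx' => exact absurd hx' hx
    | loop_step _ hp hr =>
      obtain ⟨rfl, rfl⟩ := ihp hp
      obtain ⟨rfl, rfl⟩ := ihr hr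
      exact ⟨rfl, rfl⟩

open Classical in
/-- The initial state for the input `(k, G)`, where `G` is a graph on `n` vertices: register `0`
holds `n`, register `1` holds `k`, the memory cells `0, …, n * n - 1` hold the adjacency matrix of
`G` row by row, and everything else is `0`. -/
noncomputable def inputState (k : ℕ) {n : ℕ} (G : SimpleGraph (Fin n)) : RAMState where
  reg r := if r = 0 then n else if r = 1 then k else 0
  mem a := if ∃ u v : Fin n, a = n * (u : ℕ) + (v : ℕ) ∧ G.Adj u v then 1 else 0

/-- `T(n) = O*(f(n))`, that is, `T(n) = O(f(n) * n ^ c)` for some constant `c`. -/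
def IsOStar (T f : ℕ → ℕ) : Prop :=
  ∃ c : ℕ, (fun n : ℕ => (T n : ℝ)) =O[atTop] fun n : ℕ => (f n : ℝ) * (n : ℝ) ^ c

/-! ### Reduction to ordinary colorings -/

/-! Two `k`-sets share at most `k - 1` elements exactly when they differ, so a proper `(k, k -
1)`-coloring with `q` colors is an ordinary proper coloring whose colors are the `k`-subsets of
`[q]`. Hence the answer is the least `q` with `χ(G) ≤ q.choose k`. If `G` has a vertex this `q` lies
between `k` and `k + n`, because `(k + n).choose k ≥ n + 1`.

The chromatic number comes from inclusion-exclusion over vertex sets: `G` is `j`-colorable iff some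
`j` independent sets cover all vertices. Let `i(S)` be the number of independent subsets of `S`. All
`2 ^ n` values follow from `i(S ∪ {v}) = i(S) + i(S \ N(v))` for `v ∉ S`
(`card_indepSubsets_insert`). The alternating sum of the `i(S) ^ j` is evaluated one vertex at a
time (`card_indepCovers_insert`): every intermediate value counts families of sets, so no negative
numbers arise, and `n` halvings of an array of length `2 ^ n` leave the number of covers.

All numbers and addresses stay below a bound `B` of polynomially many bits in `n` and `ℓ(k)`. The
running time is therefore at most the number of instructions, `O(n ^ 2 * 2 ^ n)`, times a polynomial
cost per instruction. Tests are expressed by truncated subtraction (`1 - x` is `1` iff `x = 0`), so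
the program consists of counting loops around straight-line code. -/

theorem hasKIColoring_pred_iff_colorable {V : Type*} (G : SimpleGraph V) {q k : ℕ} (hk : 1 ≤ k) :
    HasKIColoring G q k (k - 1) ↔ G.Colorable (q.choose k) := by
  classical
  have hcard : Fintype.card {s : Finset (Fin q) // s.card = k} = q.choose k := by simp
  -- An intersection with all `k` elements equals both sets. The converse needs `1 ≤ k`, since `k -
  -- 1 = k` for `k = 0`.
  have hne : ∀ s t : Finset (Fin q), s.card = k → t.card = k →
      ((s ∩ t).card ≤ k - 1 ↔ s ≠ t) := by
    intro s t hs ht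
    constructor
    · rintro h rfl
      rw [Finset.inter_self] at h
      omega
    · intro h
      by_contra hc
      have h1 : s ∩ t = s :=
        Finset.eq_of_subset_of_card_le Finset.inter_subset_left (by omega)
      have h2 : s ∩ t = t :=
        Finset.eq_of_subset_of_card_le Finset.inter_subset_right (by omega)
      exact h (h1.symm.trans h2)
  constructor
  · rintro ⟨h, hc, ha⟩
    rw [← hcard]
    exact SimpleGraph.Coloring.colorable (SimpleGraph.Coloring.mk
      (fun v => (⟨h v, hc v⟩ : {s : Finset (Fin q) // s.card = k}))
      (fun {u v} huv he => (hne _ _ (hc u) (hc v)).1 (ha u v huv) (congrArg Subtype.val he)))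
  · intro h
    rw [← hcard] at h
    let C := h.toColoring le_rfl (α := {s : Finset (Fin q) // s.card = k})
    exact ⟨fun v => (C v).1, fun v => (C v).2, fun u v huv =>
      (hne _ _ (C u).2 (C v).2).2 fun he => C.valid huv (Subtype.ext he)⟩

/-- The failures of an upward closed property form an initial segment, whose length is the least
witness. This lets the machine find a minimum by adding indicators, without an early exit. -/
theorem le_iff_of_count_failures {P : ℕ → Prop} [DecidablePred P] {n : ℕ}
    (hmono : ∀ a b, a ≤ b → P a → P b) (hn : P n) (j : ℕ) :
    P j ↔ (∑ i ∈ Finset.range n, if P i then 0 else 1) ≤ j := by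
  have hex : ∃ m, P m := ⟨n, hn⟩
  have hfind : ∀ i, P i ↔ Nat.find hex ≤ i := fun i =>
    ⟨fun h => Nat.find_min' hex h, fun h => hmono _ _ h (Nat.find_spec hex)⟩
  have hsum : (∑ i ∈ Finset.range n, if P i then 0 else 1) = Nat.find hex := by
    have h1 : (∑ i ∈ Finset.range n, if P i then 0 else 1) =
        ((Finset.range n).filter fun i => ¬ P i).card := by
      rw [Finset.card_filter]
      exact Finset.sum_congr rfl fun i _ => by by_cases h : P i <;> simp [h]
    have h2 : (Finset.range n).filter (fun i => ¬ P i) = Finset.range (Nat.find hex) := by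
      ext i
      have := (hfind n).1 hn
      simp only [Finset.mem_filter, Finset.mem_range, hfind]
      omega
    rw [h1, h2, Finset.card_range]
  rw [hsum, hfind]

open Classical in
/-- The chromatic number of a graph on `n` vertices, as a count of the `j < n` for which there is
no coloring with `j` colors. -/
noncomputable def chromaticCount {n : ℕ} (G : SimpleGraph (Fin n)) : ℕ :=
  ∑ j ∈ Finset.range n, if G.Colorable j then 0 else 1

theorem colorable_iff_chromaticCount_le {n : ℕ} (G : SimpleGraph (Fin n)) (j : ℕ) :
    G.Colorable j ↔ chromaticCount G ≤ j := by
  classical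
  unfold chromaticCount
  exact le_iff_of_count_failures (P := fun j => G.Colorable j)
    (fun a b hab h => h.mono hab) (by simpa using G.colorable_of_fintype) j

theorem chromaticCount_le {n : ℕ} (G : SimpleGraph (Fin n)) : chromaticCount G ≤ n :=
  (colorable_iff_chromaticCount_le G n).1 (by simpa using G.colorable_of_fintype)

/-- With `m = n` this limits the search for the palette to `n` candidates above `k`. -/
theorem succ_le_choose_add {k : ℕ} (hk : 1 ≤ k) (m : ℕ) : m + 1 ≤ (k + m).choose k := by
  calc m + 1 = (1 + m).choose m := by rw [Nat.add_comm 1 m, Nat.choose_succ_self_right]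
    _ ≤ (k + m).choose m := Nat.choose_le_choose m (by omega)
    _ = (k + m).choose k := Nat.choose_symm_add.symm

theorem kiChromaticNumber_pred_eq {n : ℕ} (G : SimpleGraph (Fin n)) {k : ℕ} (hk : 1 ≤ k) :
    kiChromaticNumber G k (k - 1) = if chromaticCount G = 0 then 0 else
      k + ∑ m ∈ Finset.range n, if chromaticCount G ≤ (k + m).choose k then 0 else 1 := by
  have hleast := kiChromaticNumber_isLeast G k (k - 1)
  have hset : {q : ℕ | HasKIColoring G q k (k - 1)} =
      {q : ℕ | chromaticCount G ≤ q.choose k} := by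
    ext q
    simp only [Set.mem_ofPred_eq, hasKIColoring_pred_iff_colorable G hk,
      colorable_iff_chromaticCount_le]
  rw [hset] at hleast
  refine hleast.unique ?_
  have hcount := le_iff_of_count_failures (n := n)
    (P := fun m => chromaticCount G ≤ (k + m).choose k)
    (fun a b hab h => h.trans (Nat.choose_le_choose k (by omega)))
    ((chromaticCount_le G).trans ((Nat.le_succ n).trans (succ_le_choose_add hk n)))
  -- Count `0` means that there are no vertices, and then no colors are needed. Otherwise `q.choose
  -- k` must be positive, which forces `k ≤ q`.
  split_ifs with h0
  · exact ⟨by simp [h0], fun q _ => Nat.zero_le q⟩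
  · refine ⟨(hcount _).2 le_rfl, fun q (hq : chromaticCount G ≤ q.choose k) => ?_⟩
    have hkq : k ≤ q := by
      by_contra hc
      rw [Nat.choose_eq_zero_of_lt (by omega)] at hq
      omega
    obtain ⟨m, rfl⟩ := Nat.exists_eq_add_of_le hkq
    have := (hcount m).1 hq
    omega

/-! ### Sets of vertices as bit masks -/

/-- The set of the positions of the binary digits `1` of a number. -/
def bitSet (x : ℕ) : Finset ℕ := (Finset.range x).filter fun i => x.testBit i

theorem mem_bitSet {x i : ℕ} : i ∈ bitSet x ↔ x.testBit i = true := by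
  simp only [bitSet, Finset.mem_filter, Finset.mem_range, and_iff_right_iff_imp]
  intro h
  exact Nat.lt_of_lt_of_le i.lt_two_pow_self (Nat.ge_two_pow_of_testBit h)

@[simp] theorem bitSet_zero : bitSet 0 = ∅ := by simp [bitSet]

theorem lt_of_mem_bitSet {x u i : ℕ} (hx : x < 2 ^ u) (hi : i ∈ bitSet x) : i < u := by
  have := Nat.ge_two_pow_of_testBit (mem_bitSet.1 hi)
  exact (Nat.pow_lt_pow_iff_right (by norm_num : 1 < 2)).1 (this.trans_lt hx)

theorem notMem_bitSet {x u : ℕ} (hx : x < 2 ^ u) : u ∉ bitSet x :=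
  fun h => lt_irrefl _ (lt_of_mem_bitSet hx h)

/-- The masks below `2 ^ (u + 1)` split into those without `u`, the lower half, and those with `u`,
the upper half. Every table below is doubled or halved along this splitting. -/
theorem bitSet_two_pow_add {x u : ℕ} (hx : x < 2 ^ u) :
    bitSet (2 ^ u + x) = insert u (bitSet x) := by
  ext i
  rw [Finset.mem_insert, mem_bitSet, mem_bitSet]
  rcases lt_trichotomy i u with h | rfl | h
  · rw [Nat.testBit_two_pow_add_gt h]
    simp [h.ne]
  · rw [Nat.testBit_two_pow_add_eq, Nat.testBit_lt_two_pow hx]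
    simp
  · have h1 : 2 ^ u + x < 2 ^ i := by
      have : 2 ^ (u + 1) ≤ 2 ^ i := Nat.pow_le_pow_right (by norm_num) h
      rw [pow_succ] at this
      omega
    rw [Nat.testBit_lt_two_pow h1, Nat.testBit_lt_two_pow (by omega)]
    simp [h.ne']

theorem card_bitSet_le {x u : ℕ} (hx : x < 2 ^ u) : (bitSet x).card ≤ u := by
  simpa using Finset.card_le_card
    (fun i hi => Finset.mem_range.2 (lt_of_mem_bitSet hx hi) : bitSet x ⊆ Finset.range u)

/-! ### Counting independent sets and covers by independent sets -/

section Counting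

variable (A : ℕ → ℕ → Prop)

open Classical in
/-- The independent sets contained in `X`. -/
noncomputable def indepSubsets (X : Finset ℕ) : Finset (Finset ℕ) :=
  X.powerset.filter fun Y => ∀ u ∈ Y, ∀ v ∈ Y, ¬ A u v

theorem mem_indepSubsets {X Y : Finset ℕ} :
    Y ∈ indepSubsets A X ↔ Y ⊆ X ∧ ∀ u ∈ Y, ∀ v ∈ Y, ¬ A u v := by
  simp [indepSubsets]

theorem indepSubsets_mono {X X' : Finset ℕ} (h : X ⊆ X') :
    indepSubsets A X ⊆ indepSubsets A X' := fun Y hY => by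
  rw [mem_indepSubsets] at hY ⊢
  exact ⟨hY.1.trans h, hY.2⟩

theorem card_indepSubsets_empty : (indepSubsets A ∅).card = 1 := by
  rw [Finset.card_eq_one]
  refine ⟨∅, ?_⟩
  ext Y
  rw [mem_indepSubsets, Finset.mem_singleton, Finset.subset_empty]
  constructor
  · exact fun h => h.1
  · rintro rfl
    simp

theorem card_indepSubsets_le (X : Finset ℕ) : (indepSubsets A X).card ≤ 2 ^ X.card := by
  classical
  rw [← Finset.card_powerset, indepSubsets]
  exact Finset.card_filter_le _ _

open Classical in
-- An independent set either avoids `v`, or is `v` together with an independent set of non-neighbors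
-- of `v`.
theorem card_indepSubsets_insert (hsymm : ∀ u v, A u v → A v u) (hirr : ∀ v, ¬ A v v)
    {X : Finset ℕ} {v : ℕ} (hv : v ∉ X) :
    (indepSubsets A (insert v X)).card =
      (indepSubsets A X).card + (indepSubsets A (X.filter fun u => ¬ A v u)).card := by
  have hsplit : indepSubsets A (insert v X) =
      indepSubsets A X ∪ (indepSubsets A (X.filter fun u => ¬ A v u)).image (insert v) := by
    ext Y
    rw [Finset.mem_union, Finset.mem_image]
    simp only [mem_indepSubsets]
    constructor
    · rintro ⟨hY, hI⟩
      by_cases hvY : v ∈ Y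
      · refine Or.inr ⟨Y.erase v, ⟨fun u hu => ?_, fun a ha b hb =>
          hI a (Finset.mem_of_mem_erase ha) b (Finset.mem_of_mem_erase hb)⟩,
          Finset.insert_erase hvY⟩
        rw [Finset.mem_erase] at hu
        exact Finset.mem_filter.2 ⟨(Finset.mem_insert.1 (hY hu.2)).resolve_left hu.1,
          hI v hvY u hu.2⟩
      · exact Or.inl ⟨(Finset.subset_insert_iff_of_notMem hvY).1 hY, hI⟩
    · rintro (⟨hY, hI⟩ | ⟨Z, ⟨hZ, hI⟩, rfl⟩)
      · exact ⟨hY.trans (Finset.subset_insert _ _), hI⟩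
      · refine ⟨Finset.insert_subset_insert _ (hZ.trans (Finset.filter_subset _ _)), ?_⟩
        intro a ha b hb
        rcases Finset.mem_insert.1 ha with rfl | ha'
        · rcases Finset.mem_insert.1 hb with rfl | hb'
          · exact hirr _
          · exact (Finset.mem_filter.1 (hZ hb')).2
        · rcases Finset.mem_insert.1 hb with rfl | hb'
          · exact fun h => (Finset.mem_filter.1 (hZ ha')).2 (hsymm _ _ h)
          · exact hI a ha' b hb'
  have hnot : ∀ Y ∈ indepSubsets A (X.filter fun u => ¬ A v u), v ∉ Y := fun Y hY h =>
    hv (Finset.mem_filter.1 (((mem_indepSubsets A).1 hY).1 h)).1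
  rw [hsplit, Finset.card_union_of_disjoint, Finset.card_image_of_injOn]
  · intro Y hY Z hZ h
    rw [← Finset.erase_insert (hnot Y hY), ← Finset.erase_insert (hnot Z hZ)]
    exact congrArg (fun T => Finset.erase T v) h
  · rw [Finset.disjoint_left]
    intro Y hY hY'
    obtain ⟨Z, -, rfl⟩ := Finset.mem_image.1 hY'
    exact hv (((mem_indepSubsets A).1 hY).1 (Finset.mem_insert_self _ _))

open Classical in
/-- The families of `j` independent sets within `X ∪ Y` that together cover `Y`. -/
noncomputable def indepCovers (j : ℕ) (X Y : Finset ℕ) : Finset (Fin j → Finset ℕ) :=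
  (Fintype.piFinset fun _ => indepSubsets A (X ∪ Y)).filter fun f => ∀ v ∈ Y, ∃ a, v ∈ f a

theorem mem_indepCovers {j : ℕ} {X Y : Finset ℕ} {f : Fin j → Finset ℕ} :
    f ∈ indepCovers A j X Y ↔ (∀ a, f a ∈ indepSubsets A (X ∪ Y)) ∧ ∀ v ∈ Y, ∃ a, v ∈ f a := by
  simp [indepCovers]

/-- Start of the recursion: with nothing to cover, the `j` sets are chosen freely. -/
theorem card_indepCovers_empty (j : ℕ) (X : Finset ℕ) :
    (indepCovers A j X ∅).card = (indepSubsets A X).card ^ j := by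
  have : indepCovers A j X ∅ = Fintype.piFinset fun _ => indepSubsets A X := by
    ext f
    simp [mem_indepCovers]
  rw [this, Fintype.card_piFinset_const]

/-- One step of inclusion-exclusion: among the families in which `v` is allowed but not required,
those that miss `v` are exactly the families without `v` in the ground set. They form a subfamily,
so the subtraction is never truncated. -/
theorem card_indepCovers_insert (j : ℕ) {X Y : Finset ℕ} {v : ℕ} (hX : v ∉ X) (hY : v ∉ Y) :
    (indepCovers A j X (insert v Y)).card =
      (indepCovers A j (insert v X) Y).card - (indepCovers A j X Y).card := by
  classical
  have hU : insert v X ∪ Y = insert v (X ∪ Y) := Finset.insert_union _ _ _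
  have hU' : X ∪ insert v Y = insert v (X ∪ Y) := Finset.union_insert _ _ _
  have hsub : indepCovers A j X Y ⊆ indepCovers A j (insert v X) Y := fun f hf => by
    rw [mem_indepCovers] at hf ⊢
    exact ⟨fun a => indepSubsets_mono A (by rw [hU]; exact Finset.subset_insert _ _) (hf.1 a), hf.2⟩
  rw [← Finset.card_sdiff_of_subset hsub]
  congr 1
  ext f
  rw [Finset.mem_sdiff, mem_indepCovers, mem_indepCovers, mem_indepCovers, hU, hU']
  constructor
  · rintro ⟨h1, h2⟩
    refine ⟨⟨h1, fun u hu => h2 u (Finset.mem_insert_of_mem hu)⟩, fun h => ?_⟩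
    obtain ⟨a, ha⟩ := h2 v (Finset.mem_insert_self _ _)
    have := ((mem_indepSubsets A).1 (h.1 a)).1 ha
    simp [hX, hY] at this
  · rintro ⟨⟨h1, h2⟩, h3⟩
    refine ⟨h1, fun u hu => ?_⟩
    rcases Finset.mem_insert.1 hu with rfl | hu
    · by_contra hc
      refine h3 ⟨fun a => ?_, h2⟩
      have ha := (mem_indepSubsets A).1 (h1 a)
      exact (mem_indepSubsets A).2
        ⟨(Finset.subset_insert_iff_of_notMem fun h => hc ⟨a, h⟩).1 ha.1, ha.2⟩
    · exact h2 u hu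

theorem card_indepCovers_le (j : ℕ) (X Y : Finset ℕ) :
    (indepCovers A j X Y).card ≤ (indepSubsets A (X ∪ Y)).card ^ j := by
  rw [← Fintype.card_piFinset_const]
  exact Finset.card_filter_le _ _

end Counting

/-- The adjacency relation of a graph on `Fin n`, extended to the natural numbers. -/
def natAdj {n : ℕ} (G : SimpleGraph (Fin n)) (u v : ℕ) : Prop :=
  ∃ (hu : u < n) (hv : v < n), G.Adj ⟨u, hu⟩ ⟨v, hv⟩

theorem natAdj_symm {n : ℕ} (G : SimpleGraph (Fin n)) (u v : ℕ) (h : natAdj G u v) :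
    natAdj G v u := by
  obtain ⟨hu, hv, h⟩ := h
  exact ⟨hv, hu, h.symm⟩

theorem not_natAdj_self {n : ℕ} (G : SimpleGraph (Fin n)) (v : ℕ) : ¬ natAdj G v v := by
  rintro ⟨_, _, h⟩
  exact h.ne rfl

/-- From a cover, each vertex takes as its color the index of a set containing it; from a coloring,
the color classes form a cover. -/
theorem card_indepCovers_range_pos {n : ℕ} (G : SimpleGraph (Fin n)) (j : ℕ) :
    0 < (indepCovers (natAdj G) j ∅ (Finset.range n)).card ↔ G.Colorable j := by
  classical
  rw [Finset.card_pos]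
  constructor
  · rintro ⟨f, hf⟩
    rw [mem_indepCovers] at hf
    choose c hc using fun v : Fin n => hf.2 v (Finset.mem_range.2 v.2)
    refine ⟨SimpleGraph.Coloring.mk c fun {u v} huv he => ?_⟩
    have hv := hc v
    rw [← he] at hv
    exact ((mem_indepSubsets _).1 (hf.1 (c u))).2 u (hc u) v hv ⟨u.2, v.2, huv⟩
  · rintro ⟨C⟩
    refine ⟨fun a => (Finset.univ.filter fun v : Fin n => C v = a).image Fin.val, ?_⟩
    rw [mem_indepCovers]
    refine ⟨fun a => (mem_indepSubsets _).2 ⟨fun u hu => ?_, ?_⟩, fun v hv => ?_⟩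
    · obtain ⟨u, -, rfl⟩ := Finset.mem_image.1 hu
      simp
    · rintro u hu v hv ⟨hun, hvn, huv⟩
      simp only [Finset.mem_image, Finset.mem_filter, Finset.mem_univ, true_and] at hu hv
      obtain ⟨u, hu, rfl⟩ := hu
      obtain ⟨v, hv, rfl⟩ := hv
      exact C.valid huv (hu.trans hv.symm)
    · exact ⟨C ⟨v, Finset.mem_range.1 hv⟩,
        Finset.mem_image.2 ⟨⟨v, Finset.mem_range.1 hv⟩, by simp, rfl⟩⟩

/-! ### A program logic with time bounds -/

/-- Assignment to a register. -/
def RAMState.set (s : RAMState) (x v : ℕ) : RAMState := ⟨Function.update s.reg x v, s.mem⟩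

/-- Assignment to a memory cell. -/
def RAMState.put (s : RAMState) (a v : ℕ) : RAMState := ⟨s.reg, Function.update s.mem a v⟩

@[simp] theorem RAMState.set_reg (s : RAMState) (x v y : ℕ) :
    (s.set x v).reg y = if y = x then v else s.reg y := Function.update_apply ..

@[simp] theorem RAMState.set_mem (s : RAMState) (x v : ℕ) : (s.set x v).mem = s.mem := rfl

@[simp] theorem RAMState.put_reg (s : RAMState) (a v : ℕ) : (s.put a v).reg = s.reg := rfl

@[simp] theorem RAMState.put_mem (s : RAMState) (a v : ℕ) :
    (s.put a v).mem = Function.update s.mem a v := rfl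

/-- All the numbers in the state are smaller than `B`. -/
def RAMState.Bounded (B : ℕ) (s : RAMState) : Prop := (∀ r, s.reg r < B) ∧ ∀ a, s.mem a < B

theorem RAMState.Bounded.set {B : ℕ} {s : RAMState} (h : s.Bounded B) {x v : ℕ} (hv : v < B) :
    (s.set x v).Bounded B :=
  ⟨fun r => by rw [RAMState.set_reg]; split_ifs; exacts [hv, h.1 r], h.2⟩

theorem RAMState.Bounded.put {B : ℕ} {s : RAMState} (h : s.Bounded B) {a v : ℕ} (hv : v < B) :
    (s.put a v).Bounded B :=
  ⟨h.1, fun b => by rw [RAMState.put_mem, Function.update_apply]; split_ifs; exacts [hv, h.2 b]⟩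

/-- An upper bound for the cost of an instruction on numbers smaller than `B`. -/
def unitCost (B : ℕ) : ℕ := (1 + Nat.size B) ^ 2

/-- From the bounded state `s`, the program `p` halts within the time of `c` instructions on numbers
smaller than `B`, in a bounded state with the property `Q`. -/
def Terminates (B : ℕ) (p : RAMProgram) (c : ℕ) (s : RAMState) (Q : RAMState → Prop) : Prop :=
  s.Bounded B → ∃ t s', RAMRun p s t s' ∧ t ≤ c * unitCost B ∧ s'.Bounded B ∧ Q s'

theorem one_add_size_le_unitCost {a B : ℕ} (ha : a < B) : 1 + Nat.size a ≤ unitCost B := by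
  have := Nat.size_le_size ha.le
  unfold unitCost
  nlinarith

theorem one_add_size_add_size_le_unitCost {a b B : ℕ} (ha : a < B) (hb : b < B) :
    1 + Nat.size a + Nat.size b ≤ unitCost B := by
  have := Nat.size_le_size ha.le
  have := Nat.size_le_size hb.le
  unfold unitCost
  nlinarith

theorem ArithOp.cost_le_unitCost (op : ArithOp) {a b B : ℕ} (ha : a < B) (hb : b < B) :
    op.cost a b ≤ unitCost B := by
  have h1 := Nat.size_le_size ha.le
  have h2 := Nat.size_le_size hb.le
  have h3 := one_add_size_add_size_le_unitCost ha hb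
  have h4 : (1 + Nat.size a) * (1 + Nat.size b) ≤ unitCost B := by
    rw [unitCost, sq]
    exact Nat.mul_le_mul (by omega) (by omega)
  cases op <;> assumption

namespace Terminates

variable {B : ℕ} {s : RAMState} {Q : RAMState → Prop}

theorem mono {p : RAMProgram} {c c' : ℕ} {Q' : RAMState → Prop} (h : Terminates B p c s Q)
    (hc : c ≤ c') (hQ : ∀ s', Q s' → Q' s') : Terminates B p c' s Q' := fun hs => by
  obtain ⟨t, s', hr, ht, hb, hq⟩ := h hs
  exact ⟨t, s', hr, ht.trans (Nat.mul_le_mul_right _ hc), hb, hQ s' hq⟩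

theorem skip (hQ : Q s) : Terminates B .skip 1 s Q := fun hs =>
  ⟨1, s, .skip s, by rw [one_mul]; exact Nat.one_le_pow _ _ (by omega), hs, hQ⟩

theorem const {x v : ℕ} (hv : v < B) (hQ : Q (s.set x v)) :
    Terminates B (.const x v) 1 s Q := fun hs =>
  ⟨_, _, .const s x v, by rw [one_mul]; exact one_add_size_le_unitCost hv, hs.set hv, hQ⟩

theorem arith {op : ArithOp} {x y z : ℕ} (hv : op.eval (s.reg y) (s.reg z) < B)
    (hQ : Q (s.set x (op.eval (s.reg y) (s.reg z)))) :
    Terminates B (.arith op x y z) 1 s Q := fun hs =>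
  ⟨_, _, .arith s op x y z, by rw [one_mul]; exact op.cost_le_unitCost (hs.1 y) (hs.1 z),
    hs.set hv, hQ⟩

theorem load {x y : ℕ} (hQ : Q (s.set x (s.mem (s.reg y)))) :
    Terminates B (.load x y) 1 s Q := fun hs =>
  ⟨_, _, .load s x y, by rw [one_mul]; exact one_add_size_add_size_le_unitCost (hs.1 y) (hs.2 _),
    hs.set (hs.2 _), hQ⟩

theorem store {x y : ℕ} (hQ : Q (s.put (s.reg x) (s.reg y))) :
    Terminates B (.store x y) 1 s Q := fun hs =>
  ⟨_, _, .store s x y, by rw [one_mul]; exact one_add_size_add_size_le_unitCost (hs.1 x) (hs.1 y),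
    hs.put (hs.1 y), hQ⟩

theorem seq {p q : RAMProgram} {c c' : ℕ}
    (h : Terminates B p c s fun s' => Terminates B q c' s' Q) :
    Terminates B (.seq p q) (c + c') s Q := fun hs => by
  obtain ⟨t, s', hr, ht, hb, hq⟩ := h hs
  obtain ⟨t', s'', hr', ht', hb', hq'⟩ := hq hb
  exact ⟨_, s'', .seq hr hr', by rw [add_mul]; exact Nat.add_le_add ht ht', hb', hq'⟩

end Terminates

/-- The number of instructions of a program without loops. -/
def RAMProgram.length : RAMProgram → ℕ
  | .seq p q => p.length + q.length
  | _ => 1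

/-- Weakest precondition of a straight-line program on numbers smaller than `B`. -/
def RAMProgram.wp (B : ℕ) : RAMProgram → (RAMState → Prop) → RAMState → Prop
  | .skip, Q, s => Q s
  | .const x v, Q, s => v < B ∧ Q (s.set x v)
  | .arith op x y z, Q, s =>
    op.eval (s.reg y) (s.reg z) < B ∧ Q (s.set x (op.eval (s.reg y) (s.reg z)))
  | .load x y, Q, s => Q (s.set x (s.mem (s.reg y)))
  | .store x y, Q, s => Q (s.put (s.reg x) (s.reg y))
  | .seq p q, Q, s => p.wp B (q.wp B Q) s
  | .cond _ _ _, _, _ => False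
  | .loop _ _, _, _ => False

/-- Reduces straight-line code to symbolic execution by `simp`, leaving only the bounds by `B` and
the final property. -/
theorem Terminates.of_wp {B : ℕ} {p : RAMProgram} {Q : RAMState → Prop} {s : RAMState}
    (h : p.wp B Q s) : Terminates B p p.length s Q := by
  induction p generalizing Q s with
  | skip => exact .skip h
  | const x v => exact .const h.1 h.2
  | arith op x y z => exact .arith h.1 h.2
  | load x y => exact .load h
  | store x y => exact .store h
  | seq p q ihp ihq => exact .seq ((ihp h).mono le_rfl fun s' hs' => ihq hs')
  | cond | loop => exact h.elim

/-- `for reg i = 0, …, reg b - 1 do body`, with the help of the register `g`. -/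
def forLoop (i b g : ℕ) (body : RAMProgram) : RAMProgram :=
  .seq (.const i 0) (.seq (.arith .sub g b i) (.loop g
    (.seq body (.seq (.const g 1) (.seq (.arith .add i i g) (.arith .sub g b i))))))

/-- Register `g` holds the number of remaining passes, on which the induction runs. A pass costs the
body, three instructions for the counters and one test; the `3` pays for the initialization and the
last test. `Inv` is required after the counter updates, hence the `set`s in `hstep`. -/
theorem Terminates.forLoop {B i b g N c : ℕ} {body : RAMProgram} {s : RAMState}
    (Inv : ℕ → RAMState → Prop) (hib : i ≠ b) (hgi : g ≠ i) (hgb : g ≠ b) (hB : 1 < B)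
    (hN : s.reg b = N) (h0 : Inv 0 ((s.set i 0).set g N))
    (hstep : ∀ m s', m < N → s'.reg i = m → s'.reg b = N → Inv m s' →
      Terminates B body c s' fun s'' => s''.reg i = m ∧ s''.reg b = N ∧
        Inv (m + 1) (((s''.set g 1).set i (m + 1)).set g (N - (m + 1)))) :
    Terminates B (forLoop i b g body) (N * (c + 4) + 3) s (Inv N) := by
  have hloop : ∀ d m s', m + d = N → s'.reg i = m → s'.reg b = N → s'.reg g = d → Inv m s' →
      Terminates B (.loop g
        (.seq body (.seq (.const g 1) (.seq (.arith .add i i g) (.arith .sub g b i)))))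
        (d * (c + 4) + 1) s' (Inv N) := by
    intro d
    induction d with
    | zero =>
      intro m s' hm _ _ hg hI hs
      obtain rfl : m = N := by omega
      refine ⟨_, _, RAMRun.loop_stop hg, ?_, hs, hI⟩
      rw [zero_mul, zero_add, one_mul]
      exact one_add_size_le_unitCost (hs.1 g)
    | succ d ih =>
      intro m s' hm hi hb hg hI hs
      have hNB : N < B := hb ▸ hs.1 b
      have hbody : Terminates B
          (.seq body (.seq (.const g 1) (.seq (.arith .add i i g) (.arith .sub g b i))))
          (c + (1 + (1 + 1))) s' fun s'' => s''.reg i = m + 1 ∧ s''.reg b = N ∧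
            s''.reg g = d ∧ Inv (m + 1) s'' := by
        refine .seq ((hstep m s' (by omega) hi hb hI).mono le_rfl ?_)
        rintro s'' ⟨hi', hb', hI'⟩
        have hd : N - (m + 1) = d := by omega
        refine .seq (.const hB (.seq (.arith ?_ (.arith ?_ ?_))))
        · simp [ArithOp.eval, hgi.symm, hi']
          omega
        · simp [ArithOp.eval, hgi.symm, hi', hb', hib.symm, hgb.symm]
          omega
        · simp only [ArithOp.eval, RAMState.set_reg, hgi.symm, hi', hb', hib.symm, hgb.symm,
            if_true, if_false, hd] at hI' ⊢
          exact ⟨trivial, trivial, trivial, hI'⟩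
      obtain ⟨t, s'', hr, ht, hs'', hi', hb', hg', hI'⟩ := hbody hs
      obtain ⟨t', s3, hr', ht', hs3, hQ⟩ := ih (m + 1) s'' (by omega) hi' hb' hg' hI' hs''
      refine ⟨_, s3, .loop_step (by omega) hr hr', ?_, hs3, hQ⟩
      have := one_add_size_le_unitCost (hs.1 g)
      calc _ ≤ unitCost B + (c + (1 + (1 + 1))) * unitCost B + (d * (c + 4) + 1) * unitCost B := by
            omega
        _ = _ := by ring
  have hstart : Terminates B (_root_.forLoop i b g body) (1 + (1 + (N * (c + 4) + 1))) s (Inv N) := by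
    intro hs
    have hNB : N < B := hN ▸ hs.1 b
    refine Terminates.seq (.const (by omega) (.seq (.arith ?_ ?_))) hs
    · simpa [ArithOp.eval, hib.symm, hN] using hNB
    · simp only [ArithOp.eval, RAMState.set_reg, hib.symm, hN, if_true, if_false, Nat.sub_zero]
      exact hloop N 0 _ (by omega) (by simp [hgi.symm]) (by simp [hgb.symm, hib.symm, hN])
        (by simp) h0
  exact hstart.mono (by omega) fun _ h => h

/-- The registers below `r₀` have the same contents in both states. -/
def AgreeBelow (r₀ : ℕ) (s s' : RAMState) : Prop := ∀ r < r₀, s'.reg r = s.reg r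

theorem AgreeBelow.refl (r₀ : ℕ) (s : RAMState) : AgreeBelow r₀ s s := fun _ _ => rfl

theorem AgreeBelow.trans {r₀ : ℕ} {s s' s'' : RAMState} (h : AgreeBelow r₀ s s')
    (h' : AgreeBelow r₀ s' s'') : AgreeBelow r₀ s s'' := fun r hr => (h' r hr).trans (h r hr)

theorem AgreeBelow.weaken {r₀ r₁ : ℕ} {s s' : RAMState} (h : AgreeBelow r₀ s s') (hr : r₁ ≤ r₀) :
    AgreeBelow r₁ s s' := fun r hr' => h r (hr'.trans_le hr)

theorem agreeBelow_set {r₀ x v : ℕ} {s s' : RAMState} (hx : r₀ ≤ x) :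
    AgreeBelow r₀ s (s'.set x v) ↔ AgreeBelow r₀ s s' := by
  refine forall₂_congr fun r hr => ?_
  rw [RAMState.set_reg, if_neg (by omega)]

@[simp] theorem agreeBelow_put {r₀ a v : ℕ} {s s' : RAMState} :
    AgreeBelow r₀ s (s'.put a v) ↔ AgreeBelow r₀ s s' := Iff.rfl

/-- The rule for a loop, with counter `20`, that fills the memory cells
`base, …, base + len - 1` with the values `F 0, …, F (len - 1)`. -/
theorem Terminates.fillLoop {B b len base : ℕ} {body : RAMProgram} {s : RAMState} (F : ℕ → ℕ)
    (hb : b < 20) (hB : 1 < B) (hlen : s.reg b = len)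
    (hstep : ∀ m s', m < len → AgreeBelow 20 s s' → s'.reg 20 = m →
      (∀ a, ¬ (base ≤ a ∧ a < base + m) → s'.mem a = s.mem a) →
      body.wp B (fun s'' => AgreeBelow 20 s' s'' ∧ s''.reg 20 = m ∧
        s''.mem = Function.update s'.mem (base + m) (F m)) s') :
    Terminates B (_root_.forLoop 20 b 21 body) (len * (body.length + 4) + 3) s fun s' =>
      AgreeBelow 20 s s' ∧ (∀ S < len, s'.mem (base + S) = F S) ∧
        ∀ a, ¬ (base ≤ a ∧ a < base + len) → s'.mem a = s.mem a := by
  refine Terminates.forLoop (fun m s' => AgreeBelow 20 s s' ∧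
    (∀ S < m, s'.mem (base + S) = F S) ∧
      ∀ a, ¬ (base ≤ a ∧ a < base + m) → s'.mem a = s.mem a)
    (by omega) (by omega) (by omega) hB hlen ?_ ?_
  · refine ⟨?_, fun S hS => absurd hS (by omega), fun a _ => rfl⟩
    rw [agreeBelow_set (by omega), agreeBelow_set (by omega)]
    exact .refl _ _
  · rintro m s' hm hi hbN ⟨hA, hF, hM⟩
    refine (Terminates.of_wp (hstep m s' hm hA hi hM)).mono le_rfl ?_
    rintro s'' ⟨hA', hi', hM'⟩
    refine ⟨hi', by rw [hA' b hb, hbN], ?_, fun S hS => ?_, fun a ha => ?_⟩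
    · rw [agreeBelow_set (by omega), agreeBelow_set (by omega), agreeBelow_set (by omega)]
      exact hA.trans hA'
    · simp only [RAMState.set_mem, hM', Function.update_apply]
      split_ifs with h
      · rw [show S = m by omega]
      · exact hF S (by omega)
    · simp only [RAMState.set_mem, hM', Function.update_apply]
      rw [if_neg (by omega), hM a (by omega)]

/-! ### The program -/

/-- Sequential execution of a list of programs. -/
def RAMProgram.block : List RAMProgram → RAMProgram
  | [] => .skip
  | p :: l => .seq p (block l)

theorem wp_block_nil {B : ℕ} {s : RAMState} {Q : RAMState → Prop} :
    (RAMProgram.block []).wp B Q s ↔ Q s := Iff.rfl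

theorem wp_block_cons {B : ℕ} {s : RAMState} {Q : RAMState → Prop} {p : RAMProgram}
    {l : List RAMProgram} : (RAMProgram.block (p :: l)).wp B Q s ↔
      p.wp B ((RAMProgram.block l).wp B Q) s := Iff.rfl

theorem Terminates.block_cons {B : ℕ} {s : RAMState} {Q R : RAMState → Prop} {p : RAMProgram}
    {l : List RAMProgram} {c c' : ℕ} (h : Terminates B p c s R)
    (h' : ∀ s', R s' → Terminates B (.block l) c' s' Q) :
    Terminates B (.block (p :: l)) (c + c') s Q := .seq (h.mono le_rfl h')

theorem Terminates.block_cons_wp {B : ℕ} {s : RAMState} {Q : RAMState → Prop} {p : RAMProgram}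
    {l : List RAMProgram} (c : ℕ) (h : p.wp B (Terminates B (.block l) c · Q) s) :
    Terminates B (.block (p :: l)) (p.length + c) s Q := .seq (.of_wp h)

theorem Terminates.block_singleton {B : ℕ} {s : RAMState} {Q : RAMState → Prop} {p : RAMProgram}
    (h : p.wp B Q s) : Terminates B (.block [p]) (p.length + 1) s Q :=
  .seq ((Terminates.of_wp h).mono le_rfl fun _ h => .skip h)

/-- Puts `2 ^ n` and the addresses of the arrays into the registers `2, …, 5`. -/
def layoutProgram : RAMProgram := .block
  [.block [.arith .mul 2 0 0, .const 3 1],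
    forLoop 20 0 21 (.arith .add 3 3 3),
    .block [.arith .add 4 2 3, .arith .add 5 4 3]]

/-- The registers hold `n`, `k`, the number `2 ^ n` of vertex sets, and the addresses of three
arrays with `2 ^ n` cells each. -/
def HasLayout (n k : ℕ) (s : RAMState) : Prop :=
  s.reg 0 = n ∧ s.reg 1 = k ∧ s.reg 2 = n * n ∧ s.reg 3 = 2 ^ n ∧
    s.reg 4 = n * n + 2 ^ n ∧ s.reg 5 = n * n + 2 ^ n + 2 ^ n

/-- Counters have larger names in inner loops (`8`, `10`, `20`), so agreement below a threshold
protects both the layout and the outer loops. -/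
theorem HasLayout.of_agreeBelow {n k r₀ : ℕ} {s s' : RAMState} (h : HasLayout n k s)
    (hA : AgreeBelow r₀ s s') (hr : 6 ≤ r₀) : HasLayout n k s' := by
  obtain ⟨h0, h1, h2, h3, h4, h5⟩ := h
  exact ⟨by rw [hA _ (by omega), h0], by rw [hA _ (by omega), h1], by rw [hA _ (by omega), h2],
    by rw [hA _ (by omega), h3], by rw [hA _ (by omega), h4], by rw [hA _ (by omega), h5]⟩

theorem layoutProgram_terminates {B n k : ℕ} {s : RAMState} (h0 : s.reg 0 = n) (h1 : s.reg 1 = k)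
    (hB : n * n + 3 * 2 ^ n + 2 < B) :
    Terminates B layoutProgram (5 * n + 11) s fun s' => HasLayout n k s' ∧ s'.mem = s.mem := by
  refine (Terminates.block_cons_wp ((n * (1 + 4) + 3) + (3 + 1)) ?_).mono ?_ fun _ h => h
  · simp only [wp_block_nil, wp_block_cons, RAMProgram.wp, ArithOp.eval, h0]
    refine ⟨by omega, by omega, .block_cons (Terminates.forLoop (N := n) (c := 1)
      (fun m s' => s'.reg 0 = n ∧ s'.reg 1 = k ∧ s'.reg 2 = n * n ∧ s'.reg 3 = 2 ^ m ∧
        s'.mem = s.mem) ?_ ?_ ?_ ?_ ?_ ?_ ?_) ?_⟩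
    any_goals omega
    · simp [h0]
    · simp [h0, h1]
    · rintro m s' hm hi - ⟨r0, r1, r2, r3, hM⟩
      have : 2 ^ (m + 1) ≤ 2 ^ n := Nat.pow_le_pow_right (by norm_num) hm
      refine .arith ?_ ?_
      · simp only [ArithOp.eval, r3]
        omega
      · simp [ArithOp.eval, r0, r1, r2, r3, hM, hi, pow_succ, mul_two]
    · rintro s' ⟨r0, r1, r2, r3, hM⟩
      refine .block_singleton ?_
      simp [wp_block_nil, wp_block_cons, RAMProgram.wp, ArithOp.eval, HasLayout, r0, r1, r2, r3, hM]
      omega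
  · simp only [RAMProgram.block, RAMProgram.length]
    omega

/-! ### Counting the independent sets -/

section Counting

variable (A : ℕ → ℕ → Prop)

open Classical in
/-- The memory starts with the adjacency matrix of `A`. -/
def StoresAdj (n : ℕ) (s : RAMState) : Prop :=
  ∀ u < n, ∀ v < n, s.mem (n * u + v) = if A u v then 1 else 0

open Classical in
/-- The array at `base` holds, for each of the first `len` sets of vertices, the set of those of its
elements that are not adjacent to `v`. -/
def StoresNonneighbors (v base len : ℕ) (s : RAMState) : Prop :=
  ∀ S < len, s.mem (base + S) ≤ S ∧
    bitSet (s.mem (base + S)) = (bitSet S).filter fun u => ¬ A v u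

/-- The array at `base` holds the numbers of independent sets in the first `len` sets of
vertices. -/
def StoresIndepCounts (base len : ℕ) (s : RAMState) : Prop :=
  ∀ S < len, s.mem (base + S) = (indepSubsets A (bitSet S)).card

variable {A}

theorem StoresAdj.congr {n : ℕ} {s s' : RAMState} (h : StoresAdj A n s)
    (hM : ∀ a < n * n, s'.mem a = s.mem a) : StoresAdj A n s' := fun u hu v hv => by
  rw [hM _ (by nlinarith), h u hu v hv]

theorem StoresIndepCounts.congr {base len : ℕ} {s s' : RAMState} (h : StoresIndepCounts A base len s)
    (hM : ∀ S < len, s'.mem (base + S) = s.mem (base + S)) : StoresIndepCounts A base len s' :=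
  fun S hS => by rw [hM S hS, h S hS]

theorem card_indepSubsets_bitSet_le {n S : ℕ} (hS : S < 2 ^ n) :
    (indepSubsets A (bitSet S)).card ≤ 2 ^ n :=
  (card_indepSubsets_le A _).trans (Nat.pow_le_pow_right (by norm_num) (card_bitSet_le hS))

/-- Appends to the array of the sets of non-neighbors of `v = reg 8` the values for the sets with
the greatest element `u = reg 10`, where `reg 14` is `2 ^ u`. -/
def nonneighborStep : RAMProgram := .block
  [.block [.arith .mul 22 0 8, .arith .add 22 22 10, .load 22 22, .const 23 1,
      .arith .sub 22 23 22, .arith .mul 15 22 14],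
    forLoop 20 14 21 (.block [.arith .add 22 4 20, .load 23 22, .arith .add 23 23 15,
      .arith .add 22 22 14, .store 22 23]),
    .arith .add 14 14 14]

/-- Adding `u` to a set `S` adds `u` to its non-neighbors of `v` iff `u` is not adjacent to `v`. So
the new half of the table is the old half shifted by a fixed `w`, either `2 ^ u` or `0`. -/
theorem nonneighborStep_terminates {B n k u v : ℕ} {s : RAMState} (hs : HasLayout n k s)
    (hB : n * n + 3 * 2 ^ n + 2 < B) (hadj : StoresAdj A n s) (hv : v < n) (hu : u < v)
    (h8 : s.reg 8 = v) (h10 : s.reg 10 = u) (h14 : s.reg 14 = 2 ^ u)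
    (hR : StoresNonneighbors A v (n * n + 2 ^ n) (2 ^ u) s) :
    Terminates B nonneighborStep (22 * 2 ^ n) s fun s' => AgreeBelow 14 s s' ∧
      s'.reg 14 = 2 ^ (u + 1) ∧ StoresNonneighbors A v (n * n + 2 ^ n) (2 ^ (u + 1)) s' ∧
      ∀ a, ¬ (n * n + 2 ^ n ≤ a ∧ a < n * n + 2 ^ n + 2 ^ n) → s'.mem a = s.mem a := by
  classical
  obtain ⟨r0, r1, r2, r3, r4, r5⟩ := hs
  have hun : 2 ^ (u + 1) ≤ 2 ^ n := Nat.pow_le_pow_right (by norm_num) (by omega)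
  have h2u : 2 ^ (u + 1) = 2 ^ u + 2 ^ u := by rw [pow_succ, mul_two]
  have hpos : 0 < 2 ^ u := by positivity
  have hvn : n * v + u < n * n := by nlinarith
  set w := (1 - if A v u then 1 else 0) * 2 ^ u with hw
  have hwle : w ≤ 2 ^ u := by rw [hw]; split_ifs <;> simp
  -- Each `block` ends with a `skip`, so the five instructions of the loop body count as `6`.
  refine (Terminates.block_cons_wp ((2 ^ u * (6 + 4) + 3) + (1 + 1)) ?_).mono ?_ fun _ h => h
  · simp only [wp_block_nil, wp_block_cons, RAMProgram.wp, ArithOp.eval, RAMState.set_reg,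
      RAMState.set_mem, Nat.reduceEqDiff, reduceIte, r0, h8, h10, h14,
      hadj v hv u (by omega), ← hw]
    refine ⟨by omega, by omega, by omega, by omega, by omega, ?_⟩
    refine .block_cons (Terminates.fillLoop (base := n * n + 2 ^ n + 2 ^ u) (len := 2 ^ u)
      (fun S => s.mem (n * n + 2 ^ n + S) + w) ?_ ?_ ?_ ?_) ?_
    any_goals omega
    · simp [h14]
    · intro m s' hm hA hi hM
      have e4 := hA 4 (by omega)
      have e14 := hA 14 (by omega)
      have e15 := hA 15 (by omega)
      have hMm := hM (n * n + 2 ^ n + m) (by omega)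
      simp [r4, h14] at e4 e14 e15 hMm
      have hle := (hR m hm).1
      simp [wp_block_nil, wp_block_cons, RAMProgram.wp, ArithOp.eval, hi, e4, e14, e15, hMm,
        agreeBelow_set, AgreeBelow.refl]
      refine ⟨by omega, by omega, by omega, by congr 1; omega⟩
    · rintro s' ⟨hA, hF, hM⟩
      refine .block_singleton ?_
      have e14 := hA 14 (by omega)
      simp [h14] at e14 hM
      simp [RAMProgram.wp, ArithOp.eval, e14]
      refine ⟨by omega, ?_, by omega, ?_, ?_⟩
      · rw [agreeBelow_set (by omega)]
        exact AgreeBelow.trans (by simp [agreeBelow_set, AgreeBelow.refl])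
          (hA.weaken (by norm_num))
      · intro S hS
        simp only [RAMState.set_mem]
        rcases lt_or_ge S (2 ^ u) with h | h
        · rw [hM _ (by omega)]
          exact hR S h
        · obtain ⟨S, rfl⟩ := Nat.exists_eq_add_of_le h
          have hS' : S < 2 ^ u := by omega
          rw [← add_assoc, hF S hS', bitSet_two_pow_add hS', Finset.filter_insert, ← (hR S hS').2]
          have hle := (hR S hS').1
          refine ⟨by omega, ?_⟩
          by_cases h : A v u
          · simp [hw, h]
          -- The old entry is at most `S < 2 ^ u`, so adding `2 ^ u` sets a free bit.
          · simp [hw, h, Nat.add_comm _ (2 ^ u), bitSet_two_pow_add (hle.trans_lt hS')]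
      · intro a ha
        exact hM a (by omega)
  · simp only [RAMProgram.block, RAMProgram.length]
    omega

/-- Computes the numbers of independent sets in all the sets of vertices with the greatest element
`v = reg 8` from the numbers for the subsets of `{0, …, v - 1}`. -/
def indepCountStep : RAMProgram := .block
  [.block [.const 22 0, .store 4 22, .const 14 1],
    forLoop 10 8 11 nonneighborStep,
    forLoop 20 14 21 (.block [.arith .add 22 4 20, .load 23 22, .arith .add 23 2 23, .load 23 23,
      .arith .add 22 2 20, .load 24 22, .arith .add 23 23 24, .arith .add 22 22 14,
      .store 22 23])]

theorem indepCountStep_terminates {B n k v : ℕ} {s : RAMState} (hsymm : ∀ u v, A u v → A v u)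
    (hirr : ∀ v, ¬ A v v) (hs : HasLayout n k s) (hB : n * n + 3 * 2 ^ n + 2 < B)
    (hadj : StoresAdj A n s) (hv : v < n) (h8 : s.reg 8 = v)
    (hI : StoresIndepCounts A (n * n) (2 ^ v) s) :
    Terminates B indepCountStep ((26 * n + 26) * 2 ^ n) s fun s' => AgreeBelow 10 s s' ∧
      StoresAdj A n s' ∧ StoresIndepCounts A (n * n) (2 ^ (v + 1)) s' := by
  classical
  have hs' := hs
  obtain ⟨r0, r1, r2, r3, r4, r5⟩ := hs'
  have hvn : 2 ^ (v + 1) ≤ 2 ^ n := Nat.pow_le_pow_right (by norm_num) (by omega)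
  have h2v : 2 ^ (v + 1) = 2 ^ v + 2 ^ v := by rw [pow_succ, mul_two]
  have hpos : 0 < 2 ^ v := by positivity
  refine (Terminates.block_cons_wp
    ((v * (22 * 2 ^ n + 4) + 3) + ((2 ^ v * (10 + 4) + 3) + 1)) ?_).mono ?_ fun _ h => h
  · simp only [wp_block_nil, wp_block_cons, RAMProgram.wp, RAMState.set_reg,
      Nat.reduceEqDiff, reduceIte, r4]
    refine ⟨by omega, by omega, .block_cons (Terminates.forLoop (N := v)
      (fun u s' => AgreeBelow 10 s s' ∧ s'.reg 14 = 2 ^ u ∧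
        StoresNonneighbors A v (n * n + 2 ^ n) (2 ^ u) s' ∧
        ∀ a, ¬ (n * n + 2 ^ n ≤ a ∧ a < n * n + 2 ^ n + 2 ^ n) → s'.mem a = s.mem a)
      ?_ ?_ ?_ ?_ ?_ ?_ ?_) ?_⟩
    any_goals omega
    · simp [h8]
    · refine ⟨by simp [agreeBelow_set, AgreeBelow.refl], by simp, ?_, ?_⟩
      · intro S hS
        obtain rfl : S = 0 := by simpa using hS
        simp
      · intro a ha
        simp [show a ≠ n * n + 2 ^ n by omega]
    · rintro u s' hu h10 - ⟨hA, h14, hR, hM⟩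
      refine (nonneighborStep_terminates (hs.of_agreeBelow hA (by norm_num)) hB
        (hadj.congr fun a ha => hM a (by omega)) hv hu ((hA 8 (by omega)).trans h8) h10 h14
        hR).mono le_rfl ?_
      rintro s'' ⟨hA', h14', hR', hM'⟩
      exact ⟨(hA' 10 (by omega)).trans h10, (hA' 8 (by omega)).trans ((hA 8 (by omega)).trans h8),
        by simpa [agreeBelow_set] using hA.trans (hA'.weaken (by norm_num)), by simpa using h14',
        hR', fun a ha => (hM' a ha).trans (hM a ha)⟩
    · rintro s' ⟨hA, h14, hR, hM⟩
      obtain ⟨t0, t1, t2, t3, t4, t5⟩ := hs.of_agreeBelow hA (by norm_num)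
      have hI' : StoresIndepCounts A (n * n) (2 ^ v) s' := hI.congr fun S hS => hM _ (by omega)
      refine .block_cons (Terminates.fillLoop (base := n * n + 2 ^ v) (len := 2 ^ v)
        (fun S => (indepSubsets A (bitSet (2 ^ v + S))).card) ?_ ?_ ?_ ?_) ?_
      any_goals omega
      · intro m s'' hm hA' hi hM'
        have e2 := (hA' 2 (by omega)).trans t2
        have e4 := (hA' 4 (by omega)).trans t4
        have e14 := (hA' 14 (by omega)).trans h14
        obtain ⟨hle, hset⟩ := hR m hm
        have l1 := hM' (n * n + 2 ^ n + m) (by omega)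
        -- The mask of non-neighbors is at most `m < 2 ^ v`, so its count lies in the half that is
        -- already computed.
        have l2 := (hM' (n * n + s'.mem (n * n + 2 ^ n + m)) (by omega)).trans
          (hI' _ (hle.trans_lt hm))
        have l3 := (hM' (n * n + m) (by omega)).trans (hI' _ hm)
        have b1 := card_indepSubsets_bitSet_le (A := A) (n := n)
          (S := s'.mem (n * n + 2 ^ n + m)) (by omega)
        have b2 := card_indepSubsets_bitSet_le (A := A) (n := n) (S := m) (by omega)
        have hrec := card_indepSubsets_insert A hsymm hirr (notMem_bitSet hm)
        rw [← bitSet_two_pow_add hm, ← hset] at hrec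
        simp [wp_block_nil, wp_block_cons, RAMProgram.wp, ArithOp.eval, hi, e2, e4, e14, l1, l2,
          l3, agreeBelow_set, AgreeBelow.refl]
        refine ⟨by omega, by omega, by omega, by omega, by omega, ?_⟩
        congr 1 <;> omega
      · rintro s'' ⟨hA', hF, hM'⟩
        refine Terminates.skip ⟨hA.trans (hA'.weaken (by norm_num)), ?_, fun S hS => ?_⟩
        · refine hadj.congr fun a ha => (hM' a (by omega)).trans (hM a (by omega))
        · rcases lt_or_ge S (2 ^ v) with h | h
          · rw [hM' _ (by omega)]
            exact hI' S h
          · obtain ⟨S, rfl⟩ := Nat.exists_eq_add_of_le h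
            rw [← add_assoc]
            exact hF S (by omega)
  · simp only [RAMProgram.block, RAMProgram.length]
    have := Nat.mul_le_mul_right (22 * 2 ^ n + 4) hv.le
    have : n * (22 * 2 ^ n + 4) = 22 * (n * 2 ^ n) + 4 * n := by ring
    have : (26 * n + 26) * 2 ^ n = 26 * (n * 2 ^ n) + 26 * 2 ^ n := by ring
    have := Nat.le_mul_of_pos_right n (show 0 < 2 ^ n by positivity)
    have : 1 ≤ 2 ^ n := Nat.one_le_two_pow
    omega

/-- Computes the numbers of independent sets in all the sets of vertices. -/
def indepCountProgram : RAMProgram := .block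
  [.block [.const 22 1, .store 2 22], forLoop 8 0 9 indepCountStep]

theorem indepCountProgram_terminates {B n k : ℕ} {s : RAMState} (hsymm : ∀ u v, A u v → A v u)
    (hirr : ∀ v, ¬ A v v) (hs : HasLayout n k s) (hB : n * n + 3 * 2 ^ n + 2 < B)
    (hadj : StoresAdj A n s) :
    Terminates B indepCountProgram (n * ((26 * n + 26) * 2 ^ n + 4) + 7) s fun s' =>
      HasLayout n k s' ∧ StoresIndepCounts A (n * n) (2 ^ n) s' := by
  have hs' := hs
  obtain ⟨r0, r1, r2, r3, r4, r5⟩ := hs'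
  refine (Terminates.block_cons_wp
    ((n * ((26 * n + 26) * 2 ^ n + 4) + 3) + 1) ?_).mono ?_ fun _ h => h
  · simp only [wp_block_nil, wp_block_cons, RAMProgram.wp, RAMState.set_reg,
      Nat.reduceEqDiff, reduceIte, r2]
    refine ⟨by omega, .block_cons (Terminates.forLoop (N := n)
      (fun v s' => AgreeBelow 8 s s' ∧ StoresAdj A n s' ∧
        StoresIndepCounts A (n * n) (2 ^ v) s') ?_ ?_ ?_ ?_ ?_ ?_ ?_) ?_⟩
    any_goals omega
    · simp [r0]
    · refine ⟨by simp [agreeBelow_set, AgreeBelow.refl], hadj.congr fun a ha => ?_, ?_⟩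
      · simp [ha.ne]
      · intro S hS
        obtain rfl : S = 0 := by simpa using hS
        simp [card_indepSubsets_empty]
    · rintro v s' hv h8 - ⟨hA, hadj', hI⟩
      refine (indepCountStep_terminates hsymm hirr (hs.of_agreeBelow hA (by norm_num)) hB hadj' hv
        h8 hI).mono le_rfl ?_
      rintro s'' ⟨hA', hadj'', hI'⟩
      exact ⟨(hA' 8 (by omega)).trans h8, (hA' 0 (by omega)).trans ((hA 0 (by omega)).trans r0),
        by simpa [agreeBelow_set] using hA.trans (hA'.weaken (by norm_num)), hadj'', hI'⟩
    · rintro s' ⟨hA, -, hI⟩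
      exact .skip ⟨hs.of_agreeBelow hA (by norm_num), hI⟩
  · simp only [RAMProgram.block, RAMProgram.length]
    omega

end Counting

/-! ### Counting the covers by independent sets -/

section Covers

variable (A : ℕ → ℕ → Prop)

/-- The array at `base` holds the `j`-th powers of the numbers of independent sets. -/
def StoresPowers (j base len : ℕ) (s : RAMState) : Prop :=
  ∀ S < len, s.mem (base + S) = (indepSubsets A (bitSet S)).card ^ j

/-- The array at `base` holds, for each set `S` of vertices smaller than `d`, the number of families
of `j` independent sets within `S ∪ {d, …, n - 1}` that cover `{d, …, n - 1}`. -/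
def StoresCovers (n j base d : ℕ) (s : RAMState) : Prop :=
  ∀ S < 2 ^ d, s.mem (base + S) = (indepCovers A j (bitSet S) (Finset.Ico d n)).card

variable {A}

/-- Keeps the powers within about `n ^ 2` bits; the next lemma does the same for the covers. -/
theorem card_indepSubsets_pow_le {n j S : ℕ} (hS : S < 2 ^ n) (hj : j ≤ n) :
    (indepSubsets A (bitSet S)).card ^ j ≤ 2 ^ (n * n) :=
  calc _ ≤ (2 ^ n) ^ j := Nat.pow_le_pow_left (card_indepSubsets_bitSet_le hS) j
    _ = 2 ^ (n * j) := (pow_mul ..).symm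
    _ ≤ 2 ^ (n * n) := Nat.pow_le_pow_right (by norm_num) (Nat.mul_le_mul_left n hj)

theorem card_indepCovers_bitSet_le {n j d S : ℕ} (hS : S < 2 ^ d) (hd : d ≤ n) (hj : j ≤ n) :
    (indepCovers A j (bitSet S) (Finset.Ico d n)).card ≤ 2 ^ (n * n) := by
  have hX : bitSet S ∪ Finset.Ico d n ⊆ Finset.range n := by
    intro v hv
    rw [Finset.mem_range]
    rcases Finset.mem_union.1 hv with h | h
    · exact (lt_of_mem_bitSet hS h).trans_le hd
    · exact (Finset.mem_Ico.1 h).2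
  have hc : (bitSet S ∪ Finset.Ico d n).card ≤ n := by simpa using Finset.card_le_card hX
  calc _ ≤ _ := card_indepCovers_le A j _ _
    _ ≤ (2 ^ n) ^ j := Nat.pow_le_pow_left ((card_indepSubsets_le A _).trans
        (Nat.pow_le_pow_right (by norm_num) hc)) j
    _ = 2 ^ (n * j) := (pow_mul ..).symm
    _ ≤ 2 ^ (n * n) := Nat.pow_le_pow_right (by norm_num) (Nat.mul_le_mul_left n hj)

/-- Halves the length `reg 14` of the array of the numbers of covers. -/
def coverStep : RAMProgram := .block
  [.block [.const 22 2, .arith .div 14 14 22],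
    forLoop 20 14 21 (.block [.arith .add 22 4 20, .load 23 22, .arith .add 24 22 14,
      .load 24 24, .arith .sub 23 24 23, .store 22 23])]

theorem coverStep_terminates {B n k j d : ℕ} {s : RAMState} (hs : HasLayout n k s)
    (hB : n * n + 3 * 2 ^ n + 2 < B) (hB' : 2 ^ (n * n) < B) (hj : j ≤ n) (hd : d < n)
    (h14 : s.reg 14 = 2 ^ (d + 1)) (hC : StoresCovers A n j (n * n + 2 ^ n) (d + 1) s) :
    Terminates B coverStep (18 * 2 ^ n) s fun s' => AgreeBelow 14 s s' ∧
      s'.reg 14 = 2 ^ d ∧ StoresCovers A n j (n * n + 2 ^ n) d s' ∧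
      ∀ a, ¬ (n * n + 2 ^ n ≤ a ∧ a < n * n + 2 ^ n + 2 ^ n) → s'.mem a = s.mem a := by
  obtain ⟨r0, r1, r2, r3, r4, r5⟩ := hs
  have hdn : 2 ^ (d + 1) ≤ 2 ^ n := Nat.pow_le_pow_right (by norm_num) (by omega)
  have h2d : 2 ^ (d + 1) = 2 ^ d + 2 ^ d := by rw [pow_succ, mul_two]
  have hpos : 0 < 2 ^ d := by positivity
  have hdiv : (2 ^ d + 2 ^ d) / 2 = 2 ^ d := by omega
  refine (Terminates.block_cons_wp ((2 ^ d * (7 + 4) + 3) + 1) ?_).mono ?_ fun _ h => h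
  · simp only [wp_block_nil, wp_block_cons, RAMProgram.wp, ArithOp.eval, RAMState.set_reg,
      Nat.reduceEqDiff, reduceIte, h14, h2d, hdiv]
    refine ⟨by omega, by omega, .block_cons (Terminates.fillLoop (base := n * n + 2 ^ n)
      (len := 2 ^ d) (fun S => (indepCovers A j (bitSet S) (Finset.Ico d n)).card)
      ?_ ?_ ?_ ?_) ?_⟩
    any_goals omega
    · simp
    · intro m s' hm hA hi hM
      have e4 := hA 4 (by omega)
      have e14 := hA 14 (by omega)
      -- The update works in place: pass `m` reads the cells `m` and `m + 2 ^ d`, neither of which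
      -- has been overwritten yet.
      have l1 := hM (n * n + 2 ^ n + m) (by omega)
      have l2 := hM (n * n + 2 ^ n + m + 2 ^ d) (by omega)
      simp only [RAMState.set_reg, RAMState.set_mem, Nat.reduceEqDiff, reduceIte, r4]
        at e4 e14 l1 l2
      rw [hC m (by omega)] at l1
      rw [add_assoc (n * n + 2 ^ n), Nat.add_comm m, hC (2 ^ d + m) (by omega)] at l2
      have hIco : Finset.Ico d n = insert d (Finset.Ico (d + 1) n) := by
        ext i
        simp only [Finset.mem_insert, Finset.mem_Ico]
        omega
      have hrec := card_indepCovers_insert A j (notMem_bitSet hm)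
        (by simp : d ∉ Finset.Ico (d + 1) n)
      rw [← hIco, ← bitSet_two_pow_add hm] at hrec
      have hb := card_indepCovers_bitSet_le (A := A) hm hd.le hj
      rw [hrec] at hb
      simp [wp_block_nil, wp_block_cons, RAMProgram.wp, ArithOp.eval, hi, e4, e14, l1,
        add_assoc (n * n + 2 ^ n), Nat.add_comm m, l2, agreeBelow_set, AgreeBelow.refl, hrec]
      omega
    · rintro s' ⟨hA, hF, hM⟩
      refine .skip ⟨?_, ?_, hF, fun a ha => hM a (by omega)⟩
      · exact AgreeBelow.trans (by simp [agreeBelow_set, AgreeBelow.refl])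
          (hA.weaken (by norm_num))
      · simpa using hA 14 (by omega)
  · simp only [RAMProgram.block, RAMProgram.length]
    omega

/-- Adds `1` to `reg 7` if there is no cover of the vertices by `reg 8` independent sets, and
multiplies the powers of the numbers of independent sets by these numbers. -/
def coverRound : RAMProgram := .block
  [forLoop 20 3 21 (.block [.arith .add 22 5 20, .load 23 22, .arith .add 22 4 20, .store 22 23]),
    .block [.const 22 0, .arith .add 14 3 22],
    forLoop 10 0 11 coverStep,
    .block [.load 22 4, .const 23 1, .arith .sub 22 23 22, .arith .add 7 7 22],
    forLoop 20 3 21 (.block [.arith .add 22 5 20, .load 23 22, .arith .add 24 2 20, .load 24 24,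
      .arith .mul 23 23 24, .store 22 23])]

theorem coverRound_terminates {B n k j x : ℕ} {s : RAMState} (hs : HasLayout n k s)
    (hB : n * n + 3 * 2 ^ n + 2 < B) (hB' : 2 ^ (n * n) < B) (hj : j < n) (h7 : s.reg 7 = x)
    (hx : x < n) (hI : StoresIndepCounts A (n * n) (2 ^ n) s)
    (hP : StoresPowers A j (n * n + 2 ^ n + 2 ^ n) (2 ^ n) s) :
    Terminates B coverRound ((22 * n + 39) * 2 ^ n) s fun s' => AgreeBelow 7 s s' ∧
      s'.reg 8 = s.reg 8 ∧ s'.reg 7 = x + (1 - (indepCovers A j ∅ (Finset.range n)).card) ∧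
      StoresIndepCounts A (n * n) (2 ^ n) s' ∧
      StoresPowers A (j + 1) (n * n + 2 ^ n + 2 ^ n) (2 ^ n) s' := by
  have hs' := hs
  obtain ⟨r0, r1, r2, r3, r4, r5⟩ := hs'
  have hpos : n < 2 ^ n := Nat.lt_two_pow_self
  refine Terminates.mono (.block_cons (Terminates.fillLoop (base := n * n + 2 ^ n)
      (len := 2 ^ n) (fun S => (indepSubsets A (bitSet S)).card ^ j)
      ?_ ?_ ?_ ?_) (c' := 3 + ((n * (18 * 2 ^ n + 4) + 3) + (5 + (2 ^ n * (7 + 4) + 3 + 1)))) ?_)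
      ?_ fun _ h => h
  any_goals omega
  · intro m s' hm hA hi hM
    have e4 := (hA 4 (by omega)).trans r4
    have e5 := (hA 5 (by omega)).trans r5
    have l1 := (hM (n * n + 2 ^ n + 2 ^ n + m) (by omega)).trans (hP m hm)
    simp [wp_block_nil, wp_block_cons, RAMProgram.wp, ArithOp.eval, hi, e4, e5, l1,
      agreeBelow_set, AgreeBelow.refl]
    omega
  · rintro s₁ ⟨hA₁, hF₁, hM₁⟩
    refine Terminates.block_cons_wp _ ?_
    simp only [wp_block_nil, wp_block_cons, RAMProgram.wp, ArithOp.eval, RAMState.set_reg,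
      Nat.reduceEqDiff, reduceIte, (hA₁ 3 (by omega)).trans r3, Nat.add_zero]
    -- After `t` halvings the vertices from `n - t` on must be covered: `t = 0` gives the copied
    -- powers, `t = n` a single cell counting the covers of all vertices. The halving destroys only
    -- the copy; the powers serve the next round.
    refine ⟨by omega, by omega, .block_cons (Terminates.forLoop (N := n)
      (fun t s' => AgreeBelow 10 s s' ∧ s'.reg 14 = 2 ^ (n - t) ∧
        StoresCovers A n j (n * n + 2 ^ n) (n - t) s' ∧
        ∀ a, ¬ (n * n + 2 ^ n ≤ a ∧ a < n * n + 2 ^ n + 2 ^ n) → s'.mem a = s.mem a)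
      ?_ ?_ ?_ ?_ ?_ ?_ ?_) ?_⟩
    any_goals omega
    · simp [(hA₁ 0 (by omega)).trans r0]
    · refine ⟨?_, by simp, fun S hS => ?_, fun a ha => hM₁ a ha⟩
      · simpa [agreeBelow_set] using hA₁.weaken (by norm_num)
      · rw [Nat.sub_zero] at hS
        simpa [card_indepCovers_empty] using hF₁ S hS
    · rintro t s' ht h10 - ⟨hA, h14, hC, hM⟩
      have hd : n - t = (n - (t + 1)) + 1 := by omega
      rw [hd] at h14 hC
      refine (coverStep_terminates (hs.of_agreeBelow hA (by norm_num)) hB hB' hj.le (by omega)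
        h14 hC).mono le_rfl ?_
      rintro s'' ⟨hA', h14', hC', hM'⟩
      exact ⟨(hA' 10 (by omega)).trans h10, (hA' 0 (by omega)).trans ((hA 0 (by omega)).trans r0),
        by simpa [agreeBelow_set] using hA.trans (hA'.weaken (by norm_num)), by simpa using h14',
        hC', fun a ha => (hM' a ha).trans (hM a ha)⟩
    · rintro s₂ ⟨hA₂, -, hC₂, hM₂⟩
      refine Terminates.block_cons_wp _ ?_
      have hval : s₂.mem (n * n + 2 ^ n) = (indepCovers A j ∅ (Finset.range n)).card := by
        have := hC₂ 0 (by positivity)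
        rwa [Nat.sub_self, bitSet_zero, ← Finset.range_eq_Ico] at this
      simp only [wp_block_nil, wp_block_cons, RAMProgram.wp, ArithOp.eval, RAMState.set_reg,
        Nat.reduceEqDiff, reduceIte, (hA₂ 4 (by omega)).trans r4,
        (hA₂ 7 (by omega)).trans h7, hval]
      refine ⟨by omega, by omega, by omega, .block_cons (Terminates.fillLoop
        (base := n * n + 2 ^ n + 2 ^ n) (len := 2 ^ n)
        (fun S => (indepSubsets A (bitSet S)).card ^ (j + 1)) ?_ ?_ ?_ ?_) ?_⟩
      any_goals omega
      · simp [(hA₂ 3 (by omega)).trans r3]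
      · intro m s' hm hA hi hM
        have e2 := hA 2 (by omega)
        have e5 := hA 5 (by omega)
        have l1 := hM (n * n + 2 ^ n + 2 ^ n + m) (by omega)
        have l2 := hM (n * n + m) (by omega)
        simp only [RAMState.set_reg, RAMState.set_mem, Nat.reduceEqDiff, reduceIte,
          (hA₂ 2 (by omega)).trans r2, (hA₂ 5 (by omega)).trans r5] at e2 e5 l1 l2
        rw [hM₂ _ (by omega), hP m hm] at l1
        rw [hM₂ _ (by omega), hI m hm] at l2
        -- Here `j < n` is read as `j + 1 ≤ n`, which bounds the next power.
        have hb := card_indepSubsets_pow_le (A := A) hm hj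
        rw [Nat.succ_eq_add_one, pow_succ] at hb
        simp [wp_block_nil, wp_block_cons, RAMProgram.wp, ArithOp.eval, hi, e2, e5, l1, l2,
          agreeBelow_set, AgreeBelow.refl, pow_succ]
        omega
      · rintro s₃ ⟨hA₃, hF₃, hM₃⟩
        refine .skip ⟨?_, ?_, ?_, ?_, hF₃⟩
        · refine AgreeBelow.trans ?_ (hA₃.weaken (by norm_num))
          simpa [agreeBelow_set] using hA₂.weaken (by norm_num)
        · simpa [hA₂ 8 (by omega)] using hA₃ 8 (by omega)
        · simpa using hA₃ 7 (by omega)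
        · exact hI.congr fun S hS => (hM₃ _ (by omega)).trans (hM₂ _ (by omega))
  · simp only [RAMProgram.block, RAMProgram.length]
    have : n * (18 * 2 ^ n + 4) = 18 * (n * 2 ^ n) + 4 * n := by ring
    have : (22 * n + 39) * 2 ^ n = 22 * (n * 2 ^ n) + 39 * 2 ^ n := by ring
    have := Nat.le_mul_of_pos_right n (Nat.zero_lt_of_lt hpos)
    omega

/-- Computes, in `reg 7`, the number of the `j < n` for which there is no cover of the vertices by `j`
independent sets. -/
def coverProgram : RAMProgram := .block
  [forLoop 20 3 21 (.block [.arith .add 22 5 20, .const 23 1, .store 22 23]),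
    .const 7 0, forLoop 8 0 9 coverRound]

theorem coverProgram_terminates {B n k : ℕ} {s : RAMState} (hs : HasLayout n k s)
    (hB : n * n + 3 * 2 ^ n + 2 < B) (hB' : 2 ^ (n * n) < B)
    (hI : StoresIndepCounts A (n * n) (2 ^ n) s) :
    Terminates B coverProgram (2 ^ n * 8 + n * ((22 * n + 39) * 2 ^ n + 4) + 8) s fun s' =>
      HasLayout n k s' ∧ s'.reg 7 = ∑ j ∈ Finset.range n,
        (1 - (indepCovers A j ∅ (Finset.range n)).card) := by
  have hs' := hs
  obtain ⟨r0, r1, r2, r3, r4, r5⟩ := hs'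
  have hpos : 0 < 2 ^ n := by positivity
  refine Terminates.mono (.block_cons (Terminates.fillLoop (base := n * n + 2 ^ n + 2 ^ n)
      (len := 2 ^ n) (fun S => 1) ?_ ?_ ?_ ?_)
      (c' := 1 + ((n * ((22 * n + 39) * 2 ^ n + 4) + 3) + 1)) ?_) ?_ fun _ h => h
  any_goals omega
  · intro m s' hm hA hi hM
    have e5 := (hA 5 (by omega)).trans r5
    simp [wp_block_nil, wp_block_cons, RAMProgram.wp, ArithOp.eval, hi, e5,
      agreeBelow_set, AgreeBelow.refl]
    omega
  · rintro s₁ ⟨hA₁, hF₁, hM₁⟩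
    refine Terminates.block_cons_wp _ ⟨by omega, .block_cons (Terminates.forLoop (N := n)
      (fun j s' => AgreeBelow 7 s s' ∧ s'.reg 7 = ∑ i ∈ Finset.range j,
          (1 - (indepCovers A i ∅ (Finset.range n)).card) ∧
        StoresIndepCounts A (n * n) (2 ^ n) s' ∧
        StoresPowers A j (n * n + 2 ^ n + 2 ^ n) (2 ^ n) s') ?_ ?_ ?_ ?_ ?_ ?_ ?_) ?_⟩
    any_goals omega
    · simp [(hA₁ 0 (by omega)).trans r0]
    · refine ⟨by simpa [agreeBelow_set] using hA₁.weaken (by norm_num), by simp,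
        hI.congr fun S hS => hM₁ _ (by omega), fun S hS => ?_⟩
      rw [pow_zero]
      exact hF₁ S hS
    · rintro j s' hj h8 - ⟨hA, h7, hI', hP⟩
      have hx : ∑ i ∈ Finset.range j, (1 - (indepCovers A i ∅ (Finset.range n)).card) ≤ j := by
        simpa using Finset.sum_le_card_nsmul (Finset.range j) _ 1 fun i _ => Nat.sub_le 1 _
      refine (coverRound_terminates (hs.of_agreeBelow hA (by norm_num)) hB hB' hj h7 (by omega)
        hI' hP).mono le_rfl ?_
      rintro s'' ⟨hA', h8', h7', hI'', hP'⟩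
      refine ⟨h8'.trans h8, (hA' 0 (by omega)).trans ((hA 0 (by omega)).trans r0),
        by simpa [agreeBelow_set] using hA.trans hA', ?_, hI'', hP'⟩
      simpa [Finset.sum_range_succ] using h7'
    · rintro s₂ ⟨hA₂, h7, -, -⟩
      exact .skip ⟨hs.of_agreeBelow hA₂ (by norm_num), h7⟩
  · simp only [RAMProgram.block, RAMProgram.length]
    omega

end Covers

/-! ### From the chromatic number to the `(k, k - 1)`-chromatic number -/

/-- Computes the least `q` with `reg 7 ≤ q.choose (reg 1)`, given that it is `0` or less than
`reg 1 + reg 0`. -/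
def paletteProgram : RAMProgram := .block
  [.block [.const 10 1, .const 14 0],
    forLoop 8 0 9 (.block [.arith .sub 22 7 10, .const 23 1, .arith .sub 22 23 22,
      .arith .sub 22 23 22, .arith .add 14 14 22, .arith .add 22 1 8, .arith .add 22 22 23,
      .arith .mul 10 10 22, .arith .add 22 8 23, .arith .div 10 10 22]),
    .block [.arith .add 14 1 14, .const 22 1, .arith .sub 23 22 7, .arith .sub 23 22 23,
      .arith .mul 0 14 23]]

/-- Bounds the product before the division. Writing the coefficient as `(k + m).choose m` keeps the
exponent independent of `k`, so the bit length is polynomial in `n` and `ℓ(k)`. -/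
theorem choose_add_mul_le {n k m : ℕ} (hm : m < n) :
    (k + m).choose k * (k + m + 1) ≤ (k + n + 1) ^ (n + 1) := by
  calc _ ≤ (k + m) ^ m * (k + m + 1) := by
        rw [Nat.choose_symm_add]
        exact Nat.mul_le_mul_right _ (Nat.choose_le_pow _ _)
    _ ≤ (k + n + 1) ^ m * (k + n + 1) :=
        Nat.mul_le_mul (Nat.pow_le_pow_left (by omega) m) (by omega)
    _ = (k + n + 1) ^ (m + 1) := (pow_succ ..).symm
    _ ≤ _ := Nat.pow_le_pow_right (by omega) (by omega)

theorem choose_add_mul_div (k m : ℕ) :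
    (k + m).choose k * (k + m + 1) / (m + 1) = (k + (m + 1)).choose k := by
  have := Nat.choose_mul_succ_eq (k + m) k
  rw [this, show k + m + 1 - k = m + 1 by omega, Nat.mul_div_cancel _ (by omega), add_assoc]

theorem paletteProgram_terminates {B n k x : ℕ} {s : RAMState} (h0 : s.reg 0 = n)
    (h1 : s.reg 1 = k) (h7 : s.reg 7 = x) (hx : x ≤ n) (hB : 2 * n + k + 2 < B)
    (hB' : (k + n + 1) ^ (n + 1) < B) :
    Terminates B paletteProgram (n * 15 + 13) s fun s' => s'.reg 0 = if x = 0 then 0 else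
      k + ∑ m ∈ Finset.range n, if x ≤ (k + m).choose k then 0 else 1 := by
  have hsum : ∀ j, (∑ m ∈ Finset.range j, if x ≤ (k + m).choose k then 0 else 1) ≤ j := fun j => by
    calc _ ≤ ∑ m ∈ Finset.range j, 1 := Finset.sum_le_sum fun i _ => by split_ifs <;> simp
      _ = j := by simp
  refine Terminates.mono (.block_cons_wp ((n * (11 + 4) + 3) + (5 + 1 + 1)) ?_) ?_ fun _ h => h
  · simp only [wp_block_nil, wp_block_cons, RAMProgram.wp]
    refine ⟨by omega, by omega, .block_cons (Terminates.forLoop (N := n) (c := 11)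
      (fun m s' => s'.reg 0 = n ∧ s'.reg 1 = k ∧ s'.reg 7 = x ∧
        s'.reg 10 = (k + m).choose k ∧
        s'.reg 14 = ∑ i ∈ Finset.range m, if x ≤ (k + i).choose k then 0 else 1)
      ?_ ?_ ?_ ?_ ?_ ?_ ?_) ?_⟩
    any_goals omega
    · simp [h0]
    · simp [h0, h1, h7]
    · rintro m s' hm h8 - ⟨e0, e1, e7, e10, e14⟩
      have hle := hsum m
      have hc := choose_add_mul_le (k := k) hm
      -- Double truncated subtraction turns a positive number into `1` and keeps `0`.
      have hind : 1 - (1 - (x - (k + m).choose k)) = if x ≤ (k + m).choose k then 0 else 1 := by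
        split_ifs <;> omega
      have hind' : (if x ≤ (k + m).choose k then 0 else 1) ≤ 1 := by split_ifs <;> simp
      refine Terminates.mono (.of_wp ?_) le_rfl fun _ h => h
      simp only [wp_block_nil, wp_block_cons, RAMProgram.wp, ArithOp.eval, RAMState.set_reg,
        Nat.reduceEqDiff, reduceIte, h8, e0, e1, e7, e10, e14, hind, choose_add_mul_div,
        Finset.sum_range_succ, and_true]
      have := (Nat.div_le_self ((k + m).choose k * (k + m + 1)) (m + 1)).trans hc
      rw [choose_add_mul_div] at this
      refine ⟨?_, ?_, ?_, ?_, ?_, ?_, ?_, ?_, ?_, ?_⟩ <;> omega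
    · rintro s' ⟨e0, e1, e7, e10, e14⟩
      have hle := hsum n
      have hind : 1 - (1 - x) = if x = 0 then 0 else 1 := by split_ifs <;> omega
      refine .block_singleton ?_
      simp only [wp_block_nil, wp_block_cons, RAMProgram.wp, ArithOp.eval, RAMState.set_reg,
        Nat.reduceEqDiff, reduceIte, e1, e7, e14, hind]
      refine ⟨by omega, by omega, by omega, by split_ifs <;> omega, ?_, ?_⟩ <;> split_ifs <;> omega
  · simp only [RAMProgram.block, RAMProgram.length]
    omega

/-! ### The whole program -/

/-- Computes the `(k, k - 1)`-chromatic number. -/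
def chromaticProgram : RAMProgram :=
  .block [layoutProgram, indepCountProgram, coverProgram, paletteProgram]

theorem storesAdj_inputState (k : ℕ) {n : ℕ} (G : SimpleGraph (Fin n)) :
    StoresAdj (natAdj G) n (inputState k G) := by
  classical
  intro u hu v hv
  have hiff : (∃ u' v' : Fin n, n * u + v = n * (u' : ℕ) + (v' : ℕ) ∧ G.Adj u' v') ↔
      natAdj G u v := by
    constructor
    · rintro ⟨u', v', he, ha⟩
      have hn : 0 < n := by omega
      have h1 : u = u' := by
        have := congrArg (· / n) he
        simpa [Nat.mul_add_div hn, Nat.div_eq_of_lt hv, Nat.div_eq_of_lt v'.2] using this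
      subst h1
      obtain rfl : v = v' := by omega
      exact ⟨hu, hv, ha⟩
    · rintro ⟨hu, hv, ha⟩
      exact ⟨⟨u, hu⟩, ⟨v, hv⟩, rfl, ha⟩
  simp only [inputState, hiff]

/-- A number that is greater than all those handled by `chromaticProgram`. -/
def numberBound (n k : ℕ) : ℕ :=
  n * n + 3 * 2 ^ n + 2 ^ (n * n) + (k + n + 1) ^ (n + 1) + 2 * n + k + 3

theorem inputState_bounded (k : ℕ) {n : ℕ} (G : SimpleGraph (Fin n)) :
    (inputState k G).Bounded (numberBound n k) := by
  have hpos : 0 < 2 ^ (n * n) := by positivity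
  constructor
  · intro r
    simp only [inputState, numberBound]
    split_ifs <;> omega
  · intro a
    simp only [inputState, numberBound]
    split_ifs <;> omega

theorem unitCost_numberBound_le {n k : ℕ} (hk : 1 ≤ k) :
    unitCost (numberBound n k) ≤ 36 * (n + 1) ^ 4 * Nat.size k ^ 2 := by
  set L := Nat.size k with hL
  have hL1 : 1 ≤ L := Nat.size_pos.2 hk
  -- Since `k + n + 1 ≤ 2 ^ (L + n)`, the power `(k + n + 1) ^ (n + 1)` is at most `2 ^ E`; moreover
  -- `E` exceeds `n * n`. The terms of `numberBound` together stay below `16 * 2 ^ E`, hence the `4`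
  -- additional bits.
  set E := (L + n) * (n + 1) with hE
  have hkL : k + 1 ≤ 2 ^ L := Nat.lt_size_self k
  have hn2 : n + 1 ≤ 2 ^ n := Nat.lt_two_pow_self
  have hkn : k + n + 1 ≤ 2 ^ (L + n) := by
    rw [pow_add]
    calc k + n + 1 ≤ (k + 1) * (n + 1) := by nlinarith
      _ ≤ _ := Nat.mul_le_mul hkL hn2
  have hEn : n * n + n ≤ E := by nlinarith
  have hLn : L + n ≤ E := Nat.le_mul_of_pos_right _ (by omega)
  have hE2 : ∀ e, e ≤ E → 2 ^ e ≤ 2 ^ E := fun e he => Nat.pow_le_pow_right (by norm_num) he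
  have b1 : 2 ^ (n * n) ≤ 2 ^ E := hE2 _ (by omega)
  have b2 : 2 ^ n ≤ 2 ^ E := hE2 _ (by omega)
  have b3 : (k + n + 1) ^ (n + 1) ≤ 2 ^ E := by
    rw [hE, pow_mul]
    exact Nat.pow_le_pow_left hkn _
  have b4 : 2 ^ (L + n) ≤ 2 ^ E := hE2 _ hLn
  have b5 : n * n < 2 ^ (n * n) := Nat.lt_two_pow_self
  have hsize : Nat.size (numberBound n k) ≤ E + 4 := by
    rw [Nat.size_le, pow_add, numberBound]
    omega
  have hEle : E ≤ L * (n + 1) ^ 2 := by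
    rw [hE, sq, ← mul_assoc]
    exact Nat.mul_le_mul_right _ (by nlinarith)
  have hEpos : 1 ≤ E := by omega
  calc unitCost (numberBound n k) ≤ (6 * (L * (n + 1) ^ 2)) ^ 2 :=
        -- `1 + (E + 4) ≤ 6 * E` because `1 ≤ E`.
        Nat.pow_le_pow_left (by omega) 2
    _ = _ := by ring

theorem isOStar_const_mul_succ_pow_mul (C c : ℕ) (f : ℕ → ℕ) :
    IsOStar (fun n => C * (n + 1) ^ c * f n) f := by
  refine ⟨c, IsBigO.of_bound (C * 2 ^ c) ?_⟩
  filter_upwards [eventually_ge_atTop 1] with n hn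
  have h1 : ((n : ℝ) + 1) ^ c ≤ 2 ^ c * (n : ℝ) ^ c := by
    rw [← mul_pow]
    have : (1 : ℝ) ≤ n := by exact_mod_cast hn
    exact pow_le_pow_left₀ (by positivity) (by linarith) c
  rw [Real.norm_of_nonneg (by positivity), Real.norm_of_nonneg (by positivity)]
  push_cast
  calc (C : ℝ) * ((n : ℝ) + 1) ^ c * f n ≤ C * (2 ^ c * (n : ℝ) ^ c) * f n := by gcongr
    _ = _ := by ring

theorem chromaticProgram_terminates {B n k : ℕ} (G : SimpleGraph (Fin n)) (hk : 1 ≤ k)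
    (hB : numberBound n k ≤ B) :
    Terminates B chromaticProgram (100 * (n + 1) ^ 2 * 2 ^ n) (inputState k G) fun s' =>
      s'.reg 0 = kiChromaticNumber G k (k - 1) := by
  classical
  unfold numberBound at hB
  have hpos : 0 < 2 ^ (n * n) := by positivity
  refine Terminates.mono (.block_cons (layoutProgram_terminates (n := n) (k := k) rfl rfl
    (by omega)) (c' := (n * ((26 * n + 26) * 2 ^ n + 4) + 7) +
      ((2 ^ n * 8 + n * ((22 * n + 39) * 2 ^ n + 4) + 8) + ((n * 15 + 13) + 1))) ?_) ?_ fun _ h => h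
  · rintro s₁ ⟨hs₁, hM₁⟩
    refine .block_cons (indepCountProgram_terminates (natAdj_symm G) (not_natAdj_self G) hs₁
      (by omega) ((storesAdj_inputState k G).congr fun a _ => congrFun hM₁ a)) ?_
    rintro s₂ ⟨hs₂, hI⟩
    refine .block_cons (coverProgram_terminates hs₂ (by omega) (by omega) hI) ?_
    rintro s₃ ⟨hs₃, h7⟩
    have hcount : s₃.reg 7 = chromaticCount G := by
      rw [h7, chromaticCount]
      refine Finset.sum_congr rfl fun j _ => ?_
      have := card_indepCovers_range_pos G j
      split_ifs with h
      · have := this.2 h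
        omega
      · have := mt this.1 h
        omega
    refine .block_cons (paletteProgram_terminates hs₃.1 hs₃.2.1 hcount (chromaticCount_le G)
      (by omega) (by omega)) fun s₄ h => .skip ?_
    rw [h, kiChromaticNumber_pred_eq G hk]
  · have h1 : 1 ≤ 2 ^ n := Nat.one_le_two_pow
    have h2 := Nat.le_mul_of_pos_right n h1
    have e1 : n * ((26 * n + 26) * 2 ^ n + 4) = 26 * (n * n * 2 ^ n) + 26 * (n * 2 ^ n) + 4 * n := by
      ring
    have e2 : n * ((22 * n + 39) * 2 ^ n + 4) = 22 * (n * n * 2 ^ n) + 39 * (n * 2 ^ n) + 4 * n := by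
      ring
    have e3 : 100 * (n + 1) ^ 2 * 2 ^ n =
        100 * (n * n * 2 ^ n) + 200 * (n * 2 ^ n) + 100 * 2 ^ n := by ring
    omega

/-- There is one program that, given `k ≥ 1` and a graph `G` on `n` vertices, halts with the
`(k, k - 1)`-chromatic number of `G` in register `0` after time `T n` times a power of the bit length
of `k`, where `T n = O*(2 ^ n)`.  In particular the time is `O*(2 ^ n)` for every fixed `k`. -/
theorem mainTheorem8 :
    ∃ (P : RAMProgram) (T : ℕ → ℕ) (d : ℕ), IsOStar T (fun n => 2 ^ n) ∧
      ∀ (k : ℕ), 1 ≤ k → ∀ (n : ℕ) (G : SimpleGraph (Fin n)),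
        ∃ (t : ℕ) (s : RAMState), RAMRun P (inputState k G) t s ∧
          s.reg 0 = kiChromaticNumber G k (k - 1) ∧ t ≤ T n * Nat.size k ^ d := by
  -- The product of `100 * (n + 1) ^ 2 * 2 ^ n` instructions and the unit cost `36 * (n + 1) ^ 4 *
  -- ℓ(k) ^ 2`.
  refine ⟨chromaticProgram, fun n => 3600 * (n + 1) ^ 6 * 2 ^ n, 2,
    isOStar_const_mul_succ_pow_mul 3600 6 _, fun k hk n G => ?_⟩
  obtain ⟨t, s, hr, ht, -, hs⟩ :=
    chromaticProgram_terminates G hk le_rfl (inputState_bounded k G)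
  refine ⟨t, s, hr, hs, ht.trans ?_⟩
  calc _ ≤ 100 * (n + 1) ^ 2 * 2 ^ n * (36 * (n + 1) ^ 4 * Nat.size k ^ 2) :=
        Nat.mul_le_mul_left _ (unitCost_numberBound_le hk)
    _ = _ := by ring
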